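/- Let $\delta\in\mathbb N$, let $\Gamma$ be a finite set and let $C\subseteq\Gamma^{\delta+1}$. Consider the LCL problem $\Pi=(\delta,\Gamma,C)$ without inputs on rooted regular trees: the instances are the finite rooted trees in which every node is either a leaf or has exactly $\delta$ children, and a labeling $L$ of the nodes with labels from $\Gamma$ is feasible if for every non-leaf node $v$ the children of $v$ can be ordered as $u_1,\dots,u_\delta$ so that $(L(v):L(u_1)\,\dots\,L(u_\delta))\in C$. In both models below algorithms are deterministic, computationally unbounded, know the number $n$ of nodes, and see the parent-child orientation of the edges. $B(v,T)$ is the set of nodes at distance at most $T$ from $v$, and $G[S]$ is the subgraph of $G$ induced by $S$. * LOCAL: an adversary gives the nodes distinct identifiers from $\{1,\dots,M(n)\}$, where $M(n)\ge n$ is a fixed polynomially bounded function. An algorithm with locality $T$ labels each node $v$ as a function of $G[B(v,T)]$ with its identifiers and of which node is $v$. * Online-LOCAL: there are no identifiers. An adversary presents the nodes in an arbitrary order $v_1,\dots,v_n$. When $v_i$ is presented, an algorithm with locality $T$ irrevocably labels $v_i$ as a function of the isomorphism type of $G\bigl[\bigcup_{j\le i}B(v_j,T)\bigr]$ together with the sequence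 $v_1,\dots,v_i$. The locality of $\Pi$ in a model is the function that maps $n$ to the least $T$ such that some algorithm with locality $T$ produces a feasible labeling on every instance with $n$ nodes, for every choice of the adversary (it is $\infty$ if there is no such $T$). A locality is $\Omega(\log n)$ if there are $c>0$ and $n_0$ such that it is at least $c\log n$ for every $n\ge n_0$ for which there is an instance with $n$ nodes. Then, for every such $\Pi$ and $M$, the problem $\Pi$ has locality $\Omega(\log n)$ in the LOCAL model if and only if it has locality $\Omega(\log n)$ in the online-LOCAL model. -/

import Mathlib

open Filter Asymptotics
open scoped ENNReal

/-- A rooted tree with node set `V`: every node other than the root has a parent, and the root is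
reached from every node by going from parent to parent. By convention the root is its own
`parent`; this loop is not an edge of the tree. -/
structure RootedTreeOn (V : Type*) where
  root : V
  parent : V → V
  parent_root : parent root = root
  reaches_root : ∀ v, ∃ k : ℕ, parent^[k] v = root

namespace RootedTreeOn

variable {V : Type*}

/-- `u` is a child of `v`. -/
def IsChild (T : RootedTreeOn V) (u v : V) : Prop :=
  u ≠ T.root ∧ T.parent u = v

/-- `v` has no children. -/
def IsLeaf (T : RootedTreeOn V) (v : V) : Prop :=
  ∀ u, ¬ T.IsChild u v

/-- Regular rooted trees with arity `δ` (full `δ`-ary trees): every node that is not a leaf has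
exactly `δ` children. -/
def IsRegular (T : RootedTreeOn V) (δ : ℕ) : Prop :=
  ∀ v, ¬ T.IsLeaf v → Nonempty (Fin δ ≃ {u // T.IsChild u v})

/-- The underlying undirected graph. -/
def graph (T : RootedTreeOn V) : SimpleGraph V :=
  SimpleGraph.fromRel T.IsChild

/-- The set `B(v, t)` of the nodes at distance at most `t` from `v`. -/
def ball (T : RootedTreeOn V) (v : V) (t : ℕ) : Set V :=
  {u | T.graph.edist v u ≤ (t : ℕ∞)}

end RootedTreeOn

/-- A piece of a rooted tree, on node names from `α`: a set of nodes, and a set of edges directed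
from the child to the parent. -/
@[ext]
structure TreePiece (α : Type*) where
  nodes : Set α
  edges : Set (α × α)

/-- Renaming the nodes of a piece. -/
def TreePiece.map {α β : Type*} (f : α → β) (g : TreePiece α) : TreePiece β where
  nodes := f '' g.nodes
  edges := Prod.map f f '' g.edges

/-- The subgraph `G[S]` of a rooted tree `G` that is induced by the set of nodes `S`, with the
orientation of the edges. -/
def RootedTreeOn.induce {V : Type*} (T : RootedTreeOn V) (S : Set V) : TreePiece V where
  nodes := S
  edges := {e | e.1 ∈ S ∧ e.2 ∈ S ∧ T.IsChild e.1 e.2}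

/-- An LCL problem `(δ, Γ, C)` on rooted regular trees without inputs: `C` is a set of allowed
configurations `(a : b₁ b₂ … b_δ)`. The set `Γ` of labels is assumed finite where it is used. -/
structure RootedTreeLCL (δ : ℕ) (Γ : Type*) where
  C : Set (Γ × (Fin δ → Γ))

namespace RootedTreeLCL

variable {δ : ℕ} {Γ : Type*}

/-- The labeling `L` is a feasible solution on the tree `T`: for every node that is not a leaf, its
label together with the labels of its children, taken in some order, is an allowed
configuration. -/
def IsSolution {V : Type*} (P : RootedTreeLCL δ Γ) (T : RootedTreeOn V) (L : V → Γ) : Prop :=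
  ∀ v, ¬ T.IsLeaf v →
    ∃ e : Fin δ ≃ {u // T.IsChild u v}, (L v, fun i => L (e i)) ∈ P.C

/-- There is a LOCAL algorithm with locality `t` that solves `P` on all regular rooted trees with
`n` nodes, when the nodes have unique identifiers from `{1, …, M}`. The algorithm `A` (which may
depend on `n`) maps the radius-`t` neighborhood of a node, in which the nodes are represented by
their identifiers, and the identifier of the node itself to the label of the node. -/
def LocalSolvable (P : RootedTreeLCL δ Γ) (M n t : ℕ) : Prop :=
  ∃ A : TreePiece ℕ → ℕ → Γ,
    ∀ T : RootedTreeOn (Fin n), T.IsRegular δ →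
    ∀ ident : Fin n → ℕ, Function.Injective ident → (∀ v, ident v ∈ Set.Icc 1 M) →
      P.IsSolution T fun v => A ((T.induce (T.ball v t)).map ident) (ident v)

/-- The locality of `P` in the LOCAL model with unique identifiers from `{1, …, M n}`, as a
function of the number `n` of nodes: the least `t` such that there is an algorithm with locality
`t`. It is `⊤` if there is no algorithm at all. (Algorithms know `n`, hence the pointwise smallest
locality function is found separately for every `n`.) -/
noncomputable def localLocality (P : RootedTreeLCL δ Γ) (M : ℕ → ℕ) (n : ℕ) : ℕ∞ :=
  ⨅ (t : ℕ) (_ : P.LocalSolvable (M n) n t), (t : ℕ∞)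

/-- The output of the online-LOCAL algorithm `A` with locality `t` when the nodes of `T` are
presented in the order `σ 0, σ 1, …, σ (n - 1)`. The node `v = σ i` gets its label when it is
presented, as a function of the subgraph `G_i` induced by the union of the radius-`t` neighborhoods
of `σ 0, …, σ i`, and of the sequence `σ 0, …, σ i` itself. -/
def onlineOutput {n : ℕ} (A : TreePiece (Fin n) → List (Fin n) → Γ) (t : ℕ)
    (T : RootedTreeOn (Fin n)) (σ : Equiv.Perm (Fin n)) (v : Fin n) : Γ :=
  A (T.induce (⋃ j ∈ Set.Iic (σ.symm v), T.ball (σ j) t))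
    ((List.ofFn σ).take ((σ.symm v : ℕ) + 1))

/-- There is an online-LOCAL algorithm with locality `t` that solves `P` on all regular rooted trees
with `n` nodes, for every order in which the nodes may be presented. There are no identifiers in
this model: the output depends only on the isomorphism class of what has been seen so far. (Any
isomorphism between two pieces with nodes in `Fin n` extends to a permutation of `Fin n`.) -/
def OnlineSolvable (P : RootedTreeLCL δ Γ) (n t : ℕ) : Prop :=
  ∃ A : TreePiece (Fin n) → List (Fin n) → Γ,
    (∀ (π : Equiv.Perm (Fin n)) (g : TreePiece (Fin n)) (s : List (Fin n)),
      A (g.map π) (s.map π) = A g s) ∧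
    ∀ T : RootedTreeOn (Fin n), T.IsRegular δ → ∀ σ : Equiv.Perm (Fin n),
      P.IsSolution T (onlineOutput A t T σ)

/-- The locality of `P` in the online-LOCAL model, as a function of the number `n` of nodes; it is
`⊤` if there is no algorithm at all. -/
noncomputable def onlineLocality (P : RootedTreeLCL δ Γ) (n : ℕ) : ℕ∞ :=
  ⨅ (t : ℕ) (_ : P.OnlineSolvable n t), (t : ℕ∞)

end RootedTreeLCL

/-- `f n = Ω(log n)`, where `n` ranges over the numbers of nodes that a regular rooted tree of arity
`δ` can have. -/
def IsOmegaLog (δ : ℕ) (f : ℕ → ℕ∞) : Prop :=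
  ∃ c : ℝ, 0 < c ∧ ∃ n₀ : ℕ, ∀ n ≥ n₀, (∃ T : RootedTreeOn (Fin n), T.IsRegular δ) →
    ENNReal.ofReal (c * Real.log n) ≤ (f n : ℝ≥0∞)

/-! A LOCAL algorithm runs in online-LOCAL with the same locality: each new label is chosen so that
some identifier assignment still explains all labels given so far (`LocalSolvable.onlineSolvable`).
At the end one assignment explains every label, so the output is a genuine output of the LOCAL
algorithm. Hence the online locality is at most the LOCAL locality.

The other direction goes through `HasCertificate`: a set of labels from which the labels `d` levels
further down can be made independent of the label on top. If the online locality is not Ω(log n),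
there are algorithms with `t` small against log n. All nodes on two adjacent levels, deep inside a
large tree, are presented first. By pigeonhole, two disjoint clusters on these levels use the same
label set. The distant subtrees can then be rearranged, unseen by the algorithm, so that the levels
below one cluster's top end up below any chosen node of the other cluster. The algorithm must
complete all these trees, and its solutions form a certificate (`OnlineSolvable.hasCertificate`).
For arity 1 there are no branches, so segments of a path are reordered instead.

Conversely, a certificate gives a LOCAL algorithm with locality o(log n)
(`HasCertificate.exists_localSolvable`). Two rounds of color reduction along the paths to the root,
followed by a search for local minima, select switches that are at least `D` apart but not too
sparse. Labels propagate downwards between switches; the independence from level `D` on lets the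
label of a switch be computed without the true label above. -/

/-! ### Balls in rooted trees. -/

namespace RootedTreeOn

variable {V : Type*} (T : RootedTreeOn V)

lemma eq_root_of_parent_eq {v : V} (h : T.parent v = v) : v = T.root := by
  obtain ⟨k, hk⟩ := T.reaches_root v
  rw [← hk, Function.iterate_fixed h]

lemma IsChild.ne {T : RootedTreeOn V} {u v : V} (h : T.IsChild u v) : u ≠ v := by
  rintro rfl
  exact h.1 (T.eq_root_of_parent_eq h.2)

lemma adj_iff {u v : V} : T.graph.Adj u v ↔ T.IsChild u v ∨ T.IsChild v u := by
  unfold graph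
  rw [SimpleGraph.fromRel_adj]
  refine ⟨fun h => h.2, fun h => ⟨?_, h⟩⟩
  rcases h with h | h
  · exact h.ne
  · exact h.ne.symm

lemma ball_zero (v : V) : T.ball v 0 = {v} := by
  ext x
  simp only [ball, Nat.cast_zero, nonpos_iff_eq_zero, Set.mem_ofPred_eq,
    SimpleGraph.edist_eq_zero_iff, Set.mem_singleton_iff]
  exact eq_comm

lemma mem_ball_succ {v x : V} {s : ℕ} :
    x ∈ T.ball v (s + 1) ↔ x ∈ T.ball v s ∨ ∃ z ∈ T.ball v s, T.graph.Adj z x := by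
  constructor
  · intro h
    have htop : T.graph.edist v x ≠ ⊤ := fun h' => by
      simp only [ball, Set.mem_ofPred_eq, h', top_le_iff] at h
      exact ENat.natCast_ne_top _ h
    obtain ⟨w, hw⟩ := SimpleGraph.exists_walk_of_edist_ne_top htop
    have hlen : w.length ≤ s + 1 := by
      simp only [ball, Set.mem_ofPred_eq, ← hw] at h
      exact_mod_cast h
    rcases Nat.lt_or_ge w.length (s + 1) with hlt | hge
    · left
      change T.graph.edist v x ≤ _
      rw [← hw]
      exact_mod_cast Nat.lt_succ_iff.mp hlt
    · right
      have hnil : ¬ w.Nil := by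
        rw [← SimpleGraph.Walk.length_eq_zero_iff]
        omega
      refine ⟨w.penultimate, ?_, w.adj_penultimate hnil⟩
      change T.graph.edist v w.penultimate ≤ _
      refine (SimpleGraph.edist_le w.dropLast).trans ?_
      have : w.dropLast.length = w.length - 1 := by simp
      rw [this]
      exact_mod_cast (by omega : w.length - 1 ≤ s)
  · rintro (h | ⟨z, hz, hadj⟩)
    · exact (show T.graph.edist v x ≤ (s : ℕ∞) from h).trans (by exact_mod_cast Nat.le_succ s)
    · refine (SimpleGraph.edist_triangle (v := z)).trans ?_
      rw [SimpleGraph.edist_eq_one_iff_adj.mpr hadj]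
      push_cast
      exact add_le_add_left hz 1

lemma self_mem_ball (v : V) (s : ℕ) : v ∈ T.ball v s := by
  simp [ball]

lemma ball_mono {v : V} {s s' : ℕ} (h : s ≤ s') : T.ball v s ⊆ T.ball v s' :=
  fun _ hx => le_trans (show T.graph.edist v _ ≤ _ from hx) (by exact_mod_cast h)

end RootedTreeOn

/-! ### Views inside pieces of a tree. -/

namespace TreePiece

variable {α β : Type*}

/-- The ball of radius `s` around `v`, along the edges of the piece. -/
def ball (g : TreePiece α) (v : α) : ℕ → Set α
  | 0 => {v}
  | s + 1 => g.ball v s ∪ {x | ∃ z ∈ g.ball v s, (z, x) ∈ g.edges ∨ (x, z) ∈ g.edges}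

/-- The part of the piece that is induced by the ball of radius `t` around `v`. -/
def view (g : TreePiece α) (t : ℕ) (v : α) : TreePiece α where
  nodes := g.ball v t
  edges := {e | e ∈ g.edges ∧ e.1 ∈ g.ball v t ∧ e.2 ∈ g.ball v t}

lemma map_map {γ : Type*} (f : α → β) (h : β → γ) (g : TreePiece α) :
    (g.map f).map h = g.map (h ∘ f) := by
  ext x
  · simp [map]
  · simp only [map, Set.image_image]
    rfl

lemma mk_mem_map_edges (f : α ≃ β) (g : TreePiece α) (x y : α) :
    (f x, f y) ∈ (g.map f).edges ↔ (x, y) ∈ g.edges := by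
  simp [map]

lemma ball_map (f : α ≃ β) (g : TreePiece α) (v : α) (s : ℕ) :
    (g.map f).ball (f v) s = f '' g.ball v s := by
  induction s with
  | zero => simp [ball]
  | succ s ih =>
    simp only [ball, ih, Set.image_union]
    congr 1
    ext x
    obtain ⟨x, rfl⟩ := f.surjective x
    rw [Set.mem_ofPred_eq, f.injective.mem_set_image, Set.mem_ofPred_eq, ← f.exists_congr_right]
    simp only [f.injective.mem_set_image, mk_mem_map_edges]

lemma view_map (f : α ≃ β) (g : TreePiece α) (t : ℕ) (v : α) :
    (g.map f).view t (f v) = (g.view t v).map f := by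
  ext x
  · simp only [view, ball_map]
    rfl
  · obtain ⟨x, y⟩ := x
    obtain ⟨x, rfl⟩ := f.surjective x
    obtain ⟨y, rfl⟩ := f.surjective y
    rw [mk_mem_map_edges]
    simp only [view, ball_map, Set.mem_ofPred_eq, mk_mem_map_edges, f.injective.mem_set_image]

lemma ball_induce {V : Type*} (T : RootedTreeOn V) {U : Set V} {v : V} {t : ℕ}
    (hU : T.ball v t ⊆ U) : ∀ s ≤ t, (T.induce U).ball v s = T.ball v s := by
  intro s
  induction s with
  | zero => intro _; rw [T.ball_zero]; rfl
  | succ s ih =>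
    intro hs
    ext x
    rw [T.mem_ball_succ]
    simp only [ball, ih (by omega), Set.mem_union, Set.mem_ofPred_eq]
    constructor
    · rintro (h | ⟨z, hz, h⟩)
      · exact Or.inl h
      · refine Or.inr ⟨z, hz, ?_⟩
        rw [T.adj_iff]
        exact h.imp (fun h => h.2.2) (fun h => h.2.2)
    · rintro (h | ⟨z, hz, h⟩)
      · exact Or.inl h
      · refine Or.inr ⟨z, hz, ?_⟩
        have hzU := hU (T.ball_mono (by omega) hz)
        have hxU : x ∈ U := hU (T.ball_mono hs (T.mem_ball_succ.mpr (Or.inr ⟨z, hz, h⟩)))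
        rw [T.adj_iff] at h
        exact h.imp (fun h => ⟨hzU, hxU, h⟩) (fun h => ⟨hxU, hzU, h⟩)

/-- Shortest paths from `v` of length at most `t` stay in the ball, hence in `U`. This recovers the
LOCAL view of a presented node from the union of balls seen online. -/
lemma view_induce {V : Type*} (T : RootedTreeOn V) {U : Set V} {v : V} {t : ℕ}
    (hU : T.ball v t ⊆ U) : (T.induce U).view t v = T.induce (T.ball v t) := by
  ext e
  · simp only [view, ball_induce T hU t le_rfl]
    rfl
  · simp only [view, ball_induce T hU t le_rfl]
    simp only [RootedTreeOn.induce, Set.mem_ofPred_eq]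
    constructor
    · rintro ⟨⟨_, _, h⟩, h1, h2⟩
      exact ⟨h1, h2, h⟩
    · rintro ⟨h1, h2, h⟩
      exact ⟨⟨hU h1, hU h2, h⟩, h1, h2⟩

end TreePiece

/-! ### Simulating LOCAL algorithms in online-LOCAL. -/

namespace RootedTreeLCL

variable {δ : ℕ} {Γ : Type*}

section Simulation

variable {V : Type*}

/-- The identifier assignment `ψ` explains the labels in `hist`: they are the outputs of the LOCAL
algorithm `A` on the radius-`t` views in the piece `g`. -/
def Explains (A : TreePiece ℕ → ℕ → Γ) (t M : ℕ) (g : TreePiece V) (hist : List (V × Γ))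
    (ψ : V → ℕ) : Prop :=
  Function.Injective ψ ∧ (∀ v, ψ v ∈ Set.Icc 1 M) ∧
    ∀ p ∈ hist, A ((g.view t p.1).map ψ) (ψ p.1) = p.2

/-- The possible outputs of `A` at `v` for identifiers that explain `hist`. -/
def candidates (A : TreePiece ℕ → ℕ → Γ) (t M : ℕ) (g : TreePiece V) (hist : List (V × Γ))
    (v : V) : Set Γ :=
  {a | ∃ ψ, Explains A t M g hist ψ ∧ A ((g.view t v).map ψ) (ψ v) = a}

/-- The history of an online simulation of `A`; the list of the presented nodes, and the history,
start with the node that is presented last. -/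
noncomputable def simulate [Nonempty Γ] (A : TreePiece ℕ → ℕ → Γ) (t M : ℕ) (g : TreePiece V) :
    List V → List (V × Γ)
  | [] => []
  | v :: s => (v, Classical.epsilon
      (· ∈ candidates A t M g (simulate A t M g s) v)) :: simulate A t M g s

variable (A : TreePiece ℕ → ℕ → Γ) (t M : ℕ)

lemma explains_map (π : Equiv.Perm V) (g : TreePiece V) (hist : List (V × Γ)) (ψ : V → ℕ) :
    Explains A t M (g.map π) (hist.map (Prod.map π id)) ψ ↔ Explains A t M g hist (ψ ∘ π) := by
  unfold Explains
  refine and_congr (by simp) (and_congr (π.forall_congr_right (q := fun v => ψ v ∈ _)).symm ?_)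
  simp only [List.forall_mem_map, Prod.map_fst, Prod.map_snd, TreePiece.view_map,
    TreePiece.map_map, id_eq, Function.comp_apply]

/-- All identifier assignments compete, so renaming the nodes merely reindexes them by `ψ ∘ π`. This
makes the simulation invariant under isomorphism. -/
lemma candidates_map (π : Equiv.Perm V) (g : TreePiece V) (hist : List (V × Γ)) (v : V) :
    candidates A t M (g.map π) (hist.map (Prod.map π id)) (π v) = candidates A t M g hist v := by
  ext a
  simp only [candidates, explains_map, Set.mem_ofPred_eq, TreePiece.view_map, TreePiece.map_map]
  constructor
  · rintro ⟨ψ, h1, h2⟩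
    exact ⟨ψ ∘ π, h1, h2⟩
  · rintro ⟨ψ, h1, h2⟩
    refine ⟨ψ ∘ π.symm, ?_, ?_⟩ <;> simpa [Function.comp_assoc] using by assumption

variable [Nonempty Γ]

lemma simulate_map (π : Equiv.Perm V) (g : TreePiece V) (s : List V) :
    simulate A t M (g.map π) (s.map π) = (simulate A t M g s).map (Prod.map π id) := by
  induction s with
  | nil => rfl
  | cons v s ih => simp [simulate, ih, candidates_map]

/-- The simulation uses the piece only through the views of presented nodes, so its run on what has
been seen so far coincides with a run on the whole tree. -/
lemma simulate_congr (g g' : TreePiece V) (s : List V) (h : ∀ v ∈ s, g.view t v = g'.view t v) :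
    simulate A t M g s = simulate A t M g' s := by
  have key : ∀ s : List V, (∀ p ∈ simulate A t M g s, p.1 ∈ s) := by
    intro s
    induction s with
    | nil => simp [simulate]
    | cons v s ih =>
      simp only [simulate, List.mem_cons]
      rintro p (rfl | hp)
      · exact Or.inl rfl
      · exact Or.inr (ih p hp)
  induction s with
  | nil => rfl
  | cons v s ih =>
    have ih' := ih fun v hv => h v (List.mem_cons_of_mem _ hv)
    have hc : candidates A t M g (simulate A t M g s) v =
        candidates A t M g' (simulate A t M g s) v := by
      ext a
      simp only [candidates, Explains, Set.mem_ofPred_eq, h v List.mem_cons_self]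
      refine exists_congr fun ψ => and_congr (and_congr Iff.rfl (and_congr Iff.rfl ?_)) Iff.rfl
      refine forall₂_congr fun p hp => ?_
      rw [h p.1 (List.mem_cons_of_mem _ (key s p hp))]
    simp [simulate, ← ih', hc]

/-- The invariant of the simulation: an assignment that explains the past makes the candidate set
nonempty, and the assignment behind the chosen candidate explains both the past and the new label.
-/
lemma exists_explains_simulate (g : TreePiece V)
    (hψ : ∃ ψ : V → ℕ, Function.Injective ψ ∧ ∀ v, ψ v ∈ Set.Icc 1 M) (s : List V) :
    ∃ ψ, Explains A t M g (simulate A t M g s) ψ := by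
  induction s with
  | nil =>
    obtain ⟨ψ, h1, h2⟩ := hψ
    exact ⟨ψ, h1, h2, by simp [simulate]⟩
  | cons v s ih =>
    obtain ⟨ψ, h⟩ := ih
    have : ∃ a, a ∈ candidates A t M g (simulate A t M g s) v := ⟨_, ψ, h, rfl⟩
    obtain ⟨ψ', h', ha⟩ := Classical.epsilon_spec this
    refine ⟨ψ', h'.1, h'.2.1, ?_⟩
    simp only [simulate, List.mem_cons]
    rintro p (rfl | hp)
    · exact ha
    · exact h'.2.2 p hp

lemma simulate_suffix (g : TreePiece V) {s s' : List V} (h : s <:+ s') :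
    simulate A t M g s <:+ simulate A t M g s' := by
  obtain ⟨l, rfl⟩ := h
  induction l with
  | nil => exact List.suffix_refl _
  | cons v l ih => exact ih.trans (List.suffix_cons _ _)

end Simulation

/-- A LOCAL algorithm can be run in the online-LOCAL model: choose labels such that some assignment
of identifiers explains all labels that have been chosen so far. -/
theorem LocalSolvable.onlineSolvable {P : RootedTreeLCL δ Γ} {M n t : ℕ} (hM : n ≤ M)
    (h : P.LocalSolvable M n t) : P.OnlineSolvable n t := by
  obtain ⟨A, hA⟩ := h
  have : Nonempty Γ := ⟨A ⟨∅, ∅⟩ 0⟩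
  -- The simulation keeps the latest node at the head, hence the reversal. The default label serves
  -- only the empty sequence, which never occurs in a run.
  refine ⟨fun g s => ((simulate A t M g s.reverse).head?.map Prod.snd).getD
    (Classical.arbitrary Γ), ?_, ?_⟩
  · intro π g s
    simp [← List.map_reverse, simulate_map, Function.comp_def]
  · intro T hT σ
    obtain ⟨ψ, hinj, hIcc, hψ⟩ := exists_explains_simulate A t M (T.induce Set.univ)
      ⟨fun v => v + 1, fun a b hab => Fin.ext (by simpa using hab),
        fun v => ⟨by simp, by have := v.2; simp only; omega⟩⟩ (List.ofFn σ).reverse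
    -- It remains to see that the online labels are the outputs of `A` for the single assignment `ψ`
    -- that explains the complete run.
    convert hA T hT ψ hinj hIcc using 1
    funext v
    set i := σ.symm v with hi
    set U : Set (Fin n) := ⋃ j ∈ Set.Iic i, T.ball (σ j) t with hU
    have htake : (List.ofFn σ).take ((i : ℕ) + 1) = (List.ofFn σ).take (i : ℕ) ++ [v] := by
      rw [List.take_add_one]
      simp [hi]
    have hcongr : simulate A t M (T.induce U) ((List.ofFn σ).take ((i : ℕ) + 1)).reverse =
        simulate A t M (T.induce Set.univ) ((List.ofFn σ).take ((i : ℕ) + 1)).reverse := by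
      refine simulate_congr A t M _ _ _ fun u hu => ?_
      rw [TreePiece.view_induce T (Set.subset_univ _), TreePiece.view_induce T]
      rw [List.mem_reverse, List.mem_take_iff_getElem] at hu
      obtain ⟨j, hj, rfl⟩ := hu
      simp only [List.length_ofFn, lt_min_iff] at hj
      have := Set.subset_biUnion_of_mem (u := fun j => T.ball (σ j) t)
        (show (⟨j, hj.2⟩ : Fin n) ∈ Set.Iic i from Fin.le_def.mpr (by simp; omega))
      simpa [hU] using this
    have hmem : (v, onlineOutput (fun g s => ((simulate A t M g s.reverse).head?.map
        Prod.snd).getD (Classical.arbitrary Γ)) t T σ v) ∈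
        simulate A t M (T.induce Set.univ) (List.ofFn σ).reverse := by
      have hsuf : ((List.ofFn σ).take ((i : ℕ) + 1)).reverse <:+ (List.ofFn σ).reverse :=
        List.reverse_suffix.mpr (List.take_prefix _ _)
      refine (simulate_suffix A t M _ hsuf).subset ?_
      simp only [onlineOutput, ← hi, ← hU, hcongr]
      rw [htake]
      simp [simulate]
    have := hψ _ hmem
    rw [TreePiece.view_induce T (Set.subset_univ _)] at this
    exact this.symm

theorem onlineLocality_le_localLocality (P : RootedTreeLCL δ Γ) {M : ℕ → ℕ} {n : ℕ}
    (hM : n ≤ M n) : P.onlineLocality n ≤ P.localLocality M n :=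
  le_iInf₂ fun t ht => iInf₂_le t (ht.onlineSolvable hM)

end RootedTreeLCL

/-! ### Certificates and the labelings they provide. -/

namespace RootedTreeLCL

variable {δ : ℕ} {Γ : Type*} (P : RootedTreeLCL δ Γ)

/-- The label `a` is allowed above the labels `b`, in some order. -/
def Allowed (a : Γ) (b : Fin δ → Γ) : Prop :=
  ∃ e : Equiv.Perm (Fin δ), (a, b ∘ e) ∈ P.C

/-- The labeling `f` of the infinite `δ`-ary tree is correct at the node `x`. -/
def AllowedAt (f : List (Fin δ) → Γ) (x : List (Fin δ)) : Prop :=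
  P.Allowed (f x) fun i => f (x ++ [i])

/-- A set `S` of labels, and for every label of `S` a correctly labeled complete tree below it whose
levels `d` and `d + 1` have labels from `S`, such that the labels of level `d` do not depend on the
label of the root. -/
def HasCertificate : Prop :=
  ∃ (S : Set Γ) (d : ℕ) (w : List (Fin δ) → Γ), S.Nonempty ∧ 0 < d ∧ ∀ a ∈ S,
    ∃ f : List (Fin δ) → Γ, f [] = a ∧ (∀ x, x.length ≤ d → P.AllowedAt f x) ∧
      (∀ x, x.length = d → f x = w x ∧ f x ∈ S) ∧ ∀ x, x.length = d + 1 → f x ∈ S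

/-- The roots of correctly labeled complete trees of depth `k` with leaf labels from `S`. -/
def rootsAbove (S : Set Γ) : ℕ → Set Γ
  | 0 => S
  | k + 1 => {a | ∃ b : Fin δ → Γ, P.Allowed a b ∧ ∀ i, b i ∈ rootsAbove S k}

lemma rootsAbove_mono {S S' : Set Γ} (h : S ⊆ S') (k : ℕ) :
    P.rootsAbove S k ⊆ P.rootsAbove S' k := by
  induction k with
  | zero => exact h
  | succ k ih =>
    rintro a ⟨b, hab, hb⟩
    exact ⟨b, hab, fun i => ih (hb i)⟩

lemma rootsAbove_add (S : Set Γ) (k l : ℕ) :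
    P.rootsAbove S (k + l) = P.rootsAbove (P.rootsAbove S k) l := by
  induction l with
  | zero => rfl
  | succ l ih => rw [← add_assoc, rootsAbove, rootsAbove, ih]

lemma subset_rootsAbove_add {S : Set Γ} {k l : ℕ} (hk : S ⊆ P.rootsAbove S k)
    (hl : S ⊆ P.rootsAbove S l) : S ⊆ P.rootsAbove S (k + l) := by
  rw [rootsAbove_add]
  exact hl.trans (P.rootsAbove_mono hk l)

lemma subset_rootsAbove_mul {S : Set Γ} {k : ℕ} (hk : S ⊆ P.rootsAbove S k) (m : ℕ) :
    S ⊆ P.rootsAbove S (m * k) := by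
  induction m with
  | zero => rw [zero_mul]; exact subset_rfl
  | succ m ih => rw [add_mul, one_mul]; exact P.subset_rootsAbove_add ih hk

/-- Every `e ≥ d * d` is a nonnegative combination of the coprime numbers `d` and `d + 1`: take `e %
d` copies of `d + 1`, which is possible as `e % d < d ≤ e / d`. This is why certificates involve two
consecutive levels. -/
lemma subset_rootsAbove_of_sq_le {S : Set Γ} {d : ℕ} (hd : 0 < d) (h : S ⊆ P.rootsAbove S d)
    (h' : S ⊆ P.rootsAbove S (d + 1)) {e : ℕ} (he : d * d ≤ e) : S ⊆ P.rootsAbove S e := by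
  have h1 : d ≤ e / d := (Nat.le_div_iff_mul_le hd).mpr he
  have h2 : e % d < d := Nat.mod_lt _ hd
  obtain ⟨m, hm⟩ : ∃ m, e / d = m + e % d := ⟨e / d - e % d, by omega⟩
  have : e = m * d + e % d * (d + 1) := by
    conv_lhs => rw [← Nat.div_add_mod e d, hm]
    ring
  rw [this]
  exact P.subset_rootsAbove_add (P.subset_rootsAbove_mul h _) (P.subset_rootsAbove_mul h' _)

lemma mem_rootsAbove_of_allowedAt {S : Set Γ} {f : List (Fin δ) → Γ} {k : ℕ}
    (hf : ∀ x, x.length < k → P.AllowedAt f x) (hS : ∀ x, x.length = k → f x ∈ S) :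
    ∀ (l : ℕ) (x : List (Fin δ)), x.length + l = k → f x ∈ P.rootsAbove S l := by
  intro l
  induction l with
  | zero => exact fun x hx => hS x hx
  | succ l ih =>
    exact fun x hx => ⟨_, hf x (by omega), fun i => ih _ (by simp; omega)⟩

/-- Every label of `rootsAbove S k` is the root of a correctly labeled tree of depth `k`. -/
lemma exists_allowedAt_of_mem_rootsAbove {S : Set Γ} {k : ℕ} {a : Γ} (ha : a ∈ P.rootsAbove S k) :
    ∃ f : List (Fin δ) → Γ, f [] = a ∧ (∀ x, x.length < k → P.AllowedAt f x) ∧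
      ∀ x, x.length = k → f x ∈ S := by
  induction k generalizing a with
  | zero => exact ⟨fun _ => a, rfl, by simp, fun _ _ => ha⟩
  | succ k ih =>
    obtain ⟨b, hab, hb⟩ := ha
    choose g hg0 hg1 hg2 using fun i => ih (hb i)
    refine ⟨fun x => match x with | [] => a | i :: x => g i x, rfl, ?_, ?_⟩
    · rintro (_ | ⟨i, x⟩) hx
      · simpa [AllowedAt, hg0] using hab
      · exact hg1 i x (by simpa using hx)
    · rintro (_ | ⟨i, x⟩) hx
      · simp at hx
      · exact hg2 i x (by simpa using hx)

/-- If every label of `W` is allowed above labels of `W`, every label of `W` is the root of a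
correctly labeled infinite tree. -/
lemma exists_allowedAt_of_closed {W : Set Γ}
    (hW : ∀ a ∈ W, ∃ b : Fin δ → Γ, P.Allowed a b ∧ ∀ i, b i ∈ W) {a : Γ} (ha : a ∈ W) :
    ∃ f : List (Fin δ) → Γ, f [] = a ∧ (∀ x, P.AllowedAt f x) ∧ ∀ x, f x ∈ W := by
  choose! b hb hbW using hW
  let f : List (Fin δ) → Γ := fun x => x.foldl b a
  have hf : ∀ x, f x ∈ W := by
    intro x
    induction x using List.reverseRecOn with
    | nil => exact ha
    | append_singleton x i ih =>
      simp only [f, List.foldl_append, List.foldl_cons, List.foldl_nil]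
      exact hbW _ ih i
  refine ⟨f, rfl, fun x => ?_, hf⟩
  have := hb _ (hf x)
  simpa [AllowedAt, f] using this

/-- The labeling `f` above level `k`, continued by the labelings `g a`. -/
def graft (f : List (Fin δ) → Γ) (k : ℕ) (g : Γ → List (Fin δ) → Γ) (x : List (Fin δ)) : Γ :=
  if x.length ≤ k then f x else g (f (x.take k)) (x.drop k)

lemma graft_of_le {f : List (Fin δ) → Γ} {k : ℕ} {g : Γ → List (Fin δ) → Γ} {x : List (Fin δ)}
    (hx : x.length ≤ k) : graft f k g x = f x :=
  if_pos hx

lemma graft_of_ge {f : List (Fin δ) → Γ} {k : ℕ} {g : Γ → List (Fin δ) → Γ} {x : List (Fin δ)}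
    (hg : ∀ x, x.length = k → g (f x) [] = f x) (hx : k ≤ x.length) :
    graft f k g x = g (f (x.take k)) (x.drop k) := by
  rcases hx.eq_or_lt with h | h
  · rw [graft_of_le h.symm.le, List.take_of_length_le h.symm.le, List.drop_of_length_le h.symm.le,
      hg x h.symm]
  · exact if_neg h.not_ge

variable {P}

lemma AllowedAt.graft_of_lt {f : List (Fin δ) → Γ} {k : ℕ} {g : Γ → List (Fin δ) → Γ}
    {x : List (Fin δ)} (hx : x.length < k) (h : P.AllowedAt f x) :
    P.AllowedAt (graft f k g) x := by
  unfold AllowedAt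
  have hi : ∀ i, graft f k g (x ++ [i]) = f (x ++ [i]) := fun i =>
    RootedTreeLCL.graft_of_le (by rw [List.length_append, List.length_singleton]; omega)
  simp only [RootedTreeLCL.graft_of_le hx.le, hi]
  exact h

lemma AllowedAt.graft_of_ge {f : List (Fin δ) → Γ} {k : ℕ} {g : Γ → List (Fin δ) → Γ}
    {x : List (Fin δ)} (hg : ∀ x, x.length = k → g (f x) [] = f x) (hx : k ≤ x.length)
    (h : P.AllowedAt (g (f (x.take k))) (x.drop k)) : P.AllowedAt (graft f k g) x := by
  unfold AllowedAt
  have hi : ∀ i, graft f k g (x ++ [i]) = g (f (x.take k)) (x.drop k ++ [i]) := fun i => by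
    rw [RootedTreeLCL.graft_of_ge hg (by rw [List.length_append]; omega),
      List.take_append_of_le_length hx, List.drop_append_of_le_length hx]
  simp only [RootedTreeLCL.graft_of_ge hg hx, hi]
  exact h

/-- Correctly labeled infinite trees for all root labels from a set `W`, with labels from `W` that
do not depend on the label of the root from level `D` on. -/
theorem HasCertificate.exists_labelings [Finite Γ] (h : P.HasCertificate) :
    ∃ (W : Set Γ) (D : ℕ) (F : Γ → List (Fin δ) → Γ), W.Nonempty ∧
      (∀ a ∈ W, F a [] = a ∧ ∀ x, P.AllowedAt (F a) x) ∧
      (∀ a ∈ W, ∀ x, D ≤ x.length → F a x ∈ W) ∧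
      ∀ a ∈ W, ∀ b ∈ W, ∀ x, D ≤ x.length → F a x = F b x := by
  obtain ⟨S, d, w, ⟨a₀, ha₀⟩, hd, hS⟩ := h
  choose! f hf0 hf1 hf2 hf3 using hS
  have hSd : S ⊆ P.rootsAbove S d := fun a ha => by
    have := P.mem_rootsAbove_of_allowedAt (f := f a) (k := d) (S := S)
      (fun x hx => hf1 a ha x hx.le) (fun x hx => (hf2 a ha x hx).2) d [] (by simp)
    rwa [hf0 a ha] at this
  have hSd' : S ⊆ P.rootsAbove S (d + 1) := fun a ha => by
    have := P.mem_rootsAbove_of_allowedAt (f := f a) (k := d + 1) (S := S)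
      (fun x hx => hf1 a ha x (by omega)) (hf3 a ha) (d + 1) [] (by simp)
    rwa [hf0 a ha] at this
  have hSe : ∀ e, d * d ≤ e → S ⊆ P.rootsAbove S e :=
    fun e he => P.subset_rootsAbove_of_sq_le hd hSd hSd' he
  set W : Set Γ := ⋃ k, P.rootsAbove S k with hW
  have hSW : S ⊆ W := Set.subset_iUnion (P.rootsAbove S) 0
  -- Each label of `W` can reach `S` at every sufficiently large depth; finiteness of `Γ` makes the
  -- threshold uniform.
  have hK : ∃ K, ∀ a ∈ W, ∀ k, K ≤ k → a ∈ P.rootsAbove S k := by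
    have h1 : ∀ a ∈ W, ∃ K, ∀ k, K ≤ k → a ∈ P.rootsAbove S k := by
      intro a ha
      obtain ⟨k, hk⟩ := Set.mem_iUnion.mp ha
      refine ⟨d * d + k, fun l hl => ?_⟩
      obtain ⟨m, rfl⟩ := Nat.exists_eq_add_of_le' (show k ≤ l by omega)
      rw [rootsAbove_add]
      exact P.rootsAbove_mono (hSe m (by omega)) k hk
    choose! K hK using h1
    obtain ⟨B, hB⟩ := (Set.finite_range K).bddAbove
    exact ⟨B, fun a ha k hk => hK a ha k ((hB (Set.mem_range_self a)).trans hk)⟩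
  obtain ⟨K, hK⟩ := hK
  have hclosed : ∀ a ∈ W, ∃ b : Fin δ → Γ, P.Allowed a b ∧ ∀ i, b i ∈ W := by
    intro a ha
    obtain ⟨b, hab, hb⟩ := hK a ha (K + 1) (by omega)
    exact ⟨b, hab, fun i => Set.mem_iUnion.mpr ⟨K, hb i⟩⟩
  have h1 : ∀ a ∈ W, ∃ f : List (Fin δ) → Γ, f [] = a ∧ (∀ x, P.AllowedAt f x) ∧ ∀ x, f x ∈ W :=
    fun a ha => P.exists_allowedAt_of_closed hclosed ha
  have h2 : ∀ a ∈ W, ∃ f : List (Fin δ) → Γ, f [] = a ∧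
      (∀ x, x.length < K → P.AllowedAt f x) ∧ ∀ x, x.length = K → f x ∈ S :=
    fun a ha => P.exists_allowedAt_of_mem_rootsAbove (hK a ha K le_rfl)
  choose! g hg0 hg1 hg2 using h1
  choose! u hu0 hu1 hu2 using h2
  -- The final labeling has three layers: `u a` brings all labels into `S` at level `K`, the
  -- certificate forgets `a` during the next `d` levels, and `g` continues inside `W` forever.
  let m : Γ → List (Fin δ) → Γ := fun a => graft (f a) d g
  have hgf : ∀ a ∈ S, ∀ x : List (Fin δ), x.length = d → g (f a x) [] = f a x :=
    fun a ha x hx => hg0 _ (hSW (hf2 a ha x hx).2)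
  have hm0 : ∀ a ∈ S, m a [] = a := fun a ha => by
    simp only [m]
    rw [graft_of_le (by simp), hf0 a ha]
  have hmu : ∀ a ∈ W, ∀ x : List (Fin δ), x.length = K → m (u a x) [] = u a x :=
    fun a ha x hx => hm0 _ (hu2 a ha x hx)
  have hm : ∀ a ∈ S, ∀ x, P.AllowedAt (m a) x := by
    intro a ha x
    rcases Nat.lt_or_ge x.length d with hx | hx
    · exact (hf1 a ha x hx.le).graft_of_lt hx
    · refine AllowedAt.graft_of_ge (hgf a ha) hx (hg1 _ (hSW ?_) _)
      exact (hf2 a ha _ (by simpa using hx)).2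
  have htail : ∀ a ∈ W, ∀ x : List (Fin δ), K + d ≤ x.length →
      graft (u a) K m x = g (w ((x.drop K).take d)) ((x.drop K).drop d) ∧
        w ((x.drop K).take d) ∈ S := by
    intro a ha x hx
    have hx' : (x.take K).length = K := by simp; omega
    have hx'' : ((x.drop K).take d).length = d := by simp; omega
    have hu := hu2 a ha _ hx'
    have hfw := hf2 _ hu _ hx''
    rw [graft_of_ge (hmu a ha) (by omega)]
    simp only [m]
    rw [graft_of_ge (hgf _ hu) (by simp; omega), ← hfw.1]
    exact ⟨rfl, hfw.2⟩
  refine ⟨W, K + d, fun a => graft (u a) K m, ⟨a₀, hSW ha₀⟩, fun a ha => ⟨?_, ?_⟩, ?_, ?_⟩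
  · exact (graft_of_le (by simp)).trans (hu0 a ha)
  · intro x
    rcases Nat.lt_or_ge x.length K with hx | hx
    · exact (hu1 a ha x hx).graft_of_lt hx
    · exact AllowedAt.graft_of_ge (hmu a ha) hx (hm _ (hu2 a ha _ (by simpa using hx)) _)
  · intro a ha x hx
    beta_reduce
    rw [(htail a ha x hx).1]
    exact hg2 _ (hSW (htail a ha x hx).2) _
  · intro a ha b hb x hx
    beta_reduce
    rw [(htail a ha x hx).1, (htail b hb x hx).1]

end RootedTreeLCL

/-! ### Color reduction along a sequence. -/

section ColorReduction

/-- A new color for a node of color `a`, from the colors `b` of its next `D` ancestors: for each of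
these ancestors, the position of a bit where its color differs from `a`, and the value of this bit
of `a`. -/
noncomputable def reducedColor (D L : ℕ) (a : ℕ) (b : Fin D → ℕ) : ℕ :=
  Fintype.equivFin (Fin D → Fin (L + 1) × Bool) fun k =>
    let j : Fin (L + 1) := Classical.epsilon fun j => a.testBit j ≠ (b k).testBit j
    (j, a.testBit j)

/-- The sequence of the new colors, for a sequence of colors. -/
noncomputable def reduceColors (D L : ℕ) (x : ℕ → ℕ) (i : ℕ) : ℕ :=
  reducedColor D L (x i) fun k => x (i + k + 1)

variable {D L : ℕ} {x y : ℕ → ℕ}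

lemma reduceColors_lt (i : ℕ) : reduceColors D L x i < (2 * (L + 1)) ^ D := by
  unfold reduceColors reducedColor
  refine (Fin.is_lt _).trans_eq ?_
  simp [mul_comm]

/-- Equal new colors would have the same bit position and bit value in the component that belongs to
offset `k`; but that position was chosen as one where the two old colors differ. -/
lemma reduceColors_ne {i k : ℕ} (hi : x i < 2 ^ (L + 1)) (hk : x (i + k) < 2 ^ (L + 1))
    (hne : x i ≠ x (i + k)) (hk0 : 0 < k) (hkD : k ≤ D) :
    reduceColors D L x i ≠ reduceColors D L x (i + k) := by
  intro h
  have h1 := congrFun ((Fintype.equivFin _).injective (Fin.ext h)) ⟨k - 1, by omega⟩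
  have hik : i + (k - 1) + 1 = i + k := by omega
  simp only [hik, Prod.mk.injEq] at h1
  have hex : ∃ j : Fin (L + 1), (x i).testBit j ≠ (x (i + k)).testBit j := by
    by_contra! hcon
    refine hne (Nat.eq_of_testBit_eq fun j => ?_)
    rcases Nat.lt_or_ge j (L + 1) with hj | hj
    · exact hcon ⟨j, hj⟩
    · rw [Nat.testBit_lt_two_pow (hi.trans_le (Nat.pow_le_pow_right two_pos hj)),
        Nat.testBit_lt_two_pow (hk.trans_le (Nat.pow_le_pow_right two_pos hj))]
  refine Classical.epsilon_spec hex ?_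
  conv_rhs => rw [h1.1]
  exact h1.2

lemma reduceColors_congr {a : ℕ} (h : ∀ i ≤ D, x (a + i) = y (a + i)) :
    reduceColors D L x a = reduceColors D L y a := by
  unfold reduceColors
  congr 1
  · exact h 0 (Nat.zero_le _)
  · funext k
    exact h (k + 1) k.2

lemma reduceColors_shift (m : ℕ) :
    reduceColors D L (fun i => x (m + i)) = fun i => reduceColors D L x (m + i) := by
  funext i
  simp [reduceColors, add_assoc]

/-- In a sequence where terms at distance at most `D` differ, there is a strict local minimum. -/
lemma exists_isLocalMin {D K : ℕ} {y : ℕ → ℕ}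
    (hy : ∀ i k, 0 < k → k ≤ D → i + k ≤ K → y i ≠ y (i + k)) :
    ∀ c i, y i = c → D * c + D ≤ i → i + D * c + D ≤ K →
      ∃ j, D ≤ j ∧ j + D ≤ K ∧ ∀ l ≤ 2 * D, l ≠ D → y j < y (j - D + l) := by
  intro c
  induction c using Nat.strong_induction_on with
  | _ c ih =>
    intro i hc h1 h2
    by_cases hmin : ∀ l ≤ 2 * D, l ≠ D → y i < y (i - D + l)
    · exact ⟨i, by omega, by omega, hmin⟩
    · push Not at hmin
      obtain ⟨l, hl, hlD, hle⟩ := hmin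
      have hne : y (i - D + l) ≠ y i := by
        rcases Nat.lt_or_gt_of_ne hlD with h | h
        · have := hy (i - D + l) (D - l) (by omega) (by omega) (by omega)
          rwa [show i - D + l + (D - l) = i by omega] at this
        · have := hy i (l - D) (by omega) (by omega) (by omega)
          rw [show i + (l - D) = i - D + l by omega] at this
          exact this.symm
      -- Moving to a smaller term costs at most `D` positions and lowers the color by at least one,
      -- so the margin `D * c` on both sides suffices for the whole descent.
      have hlt : y (i - D + l) < c := by omega
      have hmul : D * y (i - D + l) + D ≤ D * c := by
        rw [← Nat.mul_succ]
        exact Nat.mul_le_mul_left D hlt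
      exact ih _ hlt (i - D + l) rfl (by omega) (by omega)

end ColorReduction

/-! ### Ancestor paths and the information in a LOCAL view. -/

namespace RootedTreeOn

variable {V : Type*} (T : RootedTreeOn V)

/-- A repetition would make the node periodic under `parent`; enough periods lead to the root and
stay there, so the node would be the root. -/
lemma iterate_parent_ne {v : V} {i j : ℕ} (hij : i < j) (h : ∀ l < j, T.parent^[l] v ≠ T.root) :
    T.parent^[i] v ≠ T.parent^[j] v := by
  intro heq
  set w := T.parent^[i] v with hw
  have h1 : T.parent^[j - i] w = w := by
    rw [hw, ← Function.iterate_add_apply, show j - i + i = j by omega, ← heq]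
  obtain ⟨k, hk⟩ := T.reaches_root w
  refine h i hij ?_
  rw [← hw]
  have h2 : T.parent^[(j - i) * k] w = w := by
    rw [Function.iterate_mul, Function.iterate_fixed h1]
  rw [← h2]
  obtain ⟨m, hm⟩ := Nat.exists_eq_add_of_le' (Nat.le_mul_of_pos_left k (show 0 < j - i by omega))
  rw [hm, Function.iterate_add_apply, hk, Function.iterate_fixed T.parent_root]

lemma isChild_parent {v : V} (h : v ≠ T.root) : T.IsChild v (T.parent v) :=
  ⟨h, rfl⟩

lemma mem_ball_of_isChild {v x y : V} {s : ℕ} (hx : x ∈ T.ball v s)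
    (h : T.IsChild x y ∨ T.IsChild y x) : y ∈ T.ball v (s + 1) :=
  T.mem_ball_succ.mpr (Or.inr ⟨x, hx, (T.adj_iff).mpr h⟩)

lemma parent_mem_ball {v x : V} {s : ℕ} (hx : x ∈ T.ball v s) : T.parent x ∈ T.ball v (s + 1) := by
  by_cases h : x = T.root
  · rw [h, T.parent_root, ← h]
    exact T.ball_mono (Nat.le_succ s) hx
  · exact T.mem_ball_of_isChild hx (Or.inl (T.isChild_parent h))

lemma iterate_parent_mem_ball (v : V) (j : ℕ) : T.parent^[j] v ∈ T.ball v j := by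
  induction j with
  | zero => exact T.self_mem_ball v 0
  | succ j ih =>
    rw [Function.iterate_succ_apply']
    exact T.parent_mem_ball ih

variable (δ : ℕ) [NeZero δ] (ident : V → ℕ)

/-- A numbering of the nodes below `T.parent v`, that is a function of their identifiers. -/
noncomputable def port (v : V) : Fin δ :=
  (Classical.epsilon fun f : ℕ → Fin δ =>
    Set.BijOn f {k | ∃ u, T.IsChild u (T.parent v) ∧ ident u = k} Set.univ) (ident v)

-- Siblings share the same parent, so the choice in `port` picks one common bijection from their set
-- of identifiers to `Fin δ`.
variable {δ} {T ident} in
lemma exists_equiv_port (hT : T.IsRegular δ) (hid : Function.Injective ident) {v : V}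
    (hv : ¬ T.IsLeaf v) :
    ∃ e : Fin δ ≃ {u // T.IsChild u v}, ∀ i, T.port δ ident (e i) = i := by
  obtain ⟨e₀⟩ := hT v hv
  set A : Set ℕ := {k | ∃ u, T.IsChild u v ∧ ident u = k} with hA
  have hex : ∃ f : ℕ → Fin δ, Set.BijOn f A Set.univ := by
    let h : Fin δ → ℕ := fun i => ident (e₀ i)
    have hinj : Function.Injective h :=
      hid.comp (Subtype.val_injective.comp e₀.injective)
    have hinv := Function.leftInverse_invFun hinj
    refine ⟨Function.invFun h, fun _ _ => Set.mem_univ _, ?_, fun i _ => ⟨h i, ?_, hinv i⟩⟩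
    · rintro _ ⟨u, hu, rfl⟩ _ ⟨u', hu', rfl⟩ heq
      obtain ⟨i, hi⟩ := e₀.surjective ⟨u, hu⟩
      obtain ⟨i', hi'⟩ := e₀.surjective ⟨u', hu'⟩
      have h1 : h i = ident u := by simp [h, hi]
      have h2 : h i' = ident u' := by simp [h, hi']
      rw [← h1, ← h2, hinv, hinv] at heq
      rw [← h1, ← h2, heq]
    · exact ⟨e₀ i, (e₀ i).2, rfl⟩
  have hf := Classical.epsilon_spec hex
  set f := Classical.epsilon fun f : ℕ → Fin δ => Set.BijOn f A Set.univ with hfdef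
  have hport : ∀ u : {u // T.IsChild u v}, T.port δ ident u = f (ident u) := by
    intro u
    simp only [port, u.2.2, hfdef, hA]
  have hbij : Function.Bijective fun u : {u // T.IsChild u v} => T.port δ ident u := by
    constructor
    · intro u u' h
      simp only [hport] at h
      exact Subtype.ext (hid (hf.2.1 ⟨u, u.2, rfl⟩ ⟨u', u'.2, rfl⟩ h))
    · intro i
      obtain ⟨_, ⟨u, hu, rfl⟩, hi⟩ := hf.2.2 (Set.mem_univ i)
      exact ⟨⟨u, hu⟩, (hport ⟨u, hu⟩).trans hi⟩
  refine ⟨(Equiv.ofBijective _ hbij).symm, fun i => ?_⟩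
  exact (Equiv.ofBijective _ hbij).apply_symm_apply i

/-- The ports on the path to `v` from its `k`-th ancestor. -/
noncomputable def portPath : ℕ → V → List (Fin δ)
  | 0, _ => []
  | k + 1, v => portPath k (T.parent v) ++ [T.port δ ident v]

lemma length_portPath (k : ℕ) (v : V) : (T.portPath δ ident k v).length = k := by
  induction k generalizing v with
  | zero => rfl
  | succ k ih => simp [portPath, ih]

/-- The two nodes have the same sequence of identifiers and ports on the paths to their `m`-th
ancestors. -/
def SameAncestors (T' : RootedTreeOn V) (ident' : V → ℕ) (m : ℕ) (v v' : V) : Prop :=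
  ∀ j ≤ m, ident (T.parent^[j] v) = ident' (T'.parent^[j] v') ∧
    (T.parent^[j] v = T.root ↔ T'.parent^[j] v' = T'.root) ∧
    T.port δ ident (T.parent^[j] v) = T'.port δ ident' (T'.parent^[j] v')

section SameAncestors

variable {δ T ident} {T' : RootedTreeOn V} {ident' : V → ℕ} {m : ℕ} {v v' : V}

lemma SameAncestors.mono (h : T.SameAncestors δ ident T' ident' m v v') {k : ℕ} (hk : k ≤ m) :
    T.SameAncestors δ ident T' ident' k v v' :=
  fun j hj => h j (hj.trans hk)

lemma SameAncestors.iterate {k : ℕ} (h : T.SameAncestors δ ident T' ident' (m + k) v v') :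
    T.SameAncestors δ ident T' ident' m (T.parent^[k] v) (T'.parent^[k] v') := by
  intro j hj
  simp only [← Function.iterate_add_apply]
  exact h (j + k) (by omega)

lemma SameAncestors.portPath_eq {k : ℕ} (h : T.SameAncestors δ ident T' ident' k v v') :
    T.portPath δ ident k v = T'.portPath δ ident' k v' := by
  induction k generalizing v v' with
  | zero => rfl
  | succ k ih =>
    have h1 := ih (h.iterate (m := k) (k := 1))
    rw [Function.iterate_one, Function.iterate_one] at h1
    have h2 := (h 0 (Nat.zero_le _)).2.2
    rw [Function.iterate_zero_apply, Function.iterate_zero_apply] at h2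
    rw [portPath, portPath, h1, h2]

lemma mem_map_induce_edges {S : Set V} {a b : ℕ} :
    (a, b) ∈ ((T.induce S).map ident).edges ↔
      ∃ u ∈ S, ∃ w ∈ S, T.IsChild u w ∧ ident u = a ∧ ident w = b := by
  simp only [TreePiece.map, induce, Set.mem_image, Set.mem_ofPred_eq, Prod.exists,
    Prod.map_apply, Prod.mk.injEq]
  constructor
  · rintro ⟨u, w, ⟨h1, h2, h3⟩, h4, h5⟩
    exact ⟨u, h1, w, h2, h3, h4, h5⟩
  · rintro ⟨u, h1, w, h2, h3, h4, h5⟩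
    exact ⟨u, w, ⟨h1, h2, h3⟩, h4, h5⟩

lemma isChild_of_views_eq (hid' : Function.Injective ident') {t : ℕ}
    (hview : (T.induce (T.ball v t)).map ident = (T'.induce (T'.ball v' t)).map ident')
    {u w w' : V} (hu : u ∈ T.ball v t) (hw : w ∈ T.ball v t) (h : T.IsChild u w)
    (hw' : ident w = ident' w') : ∃ u', T'.IsChild u' w' ∧ ident' u' = ident u := by
  have h1 : (ident u, ident w) ∈ ((T.induce (T.ball v t)).map ident).edges :=
    mem_map_induce_edges.mpr ⟨u, hu, w, hw, h, rfl, rfl⟩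
  rw [hview, mem_map_induce_edges] at h1
  obtain ⟨u', -, w'', -, h2, h3, h4⟩ := h1
  rw [hw'] at h4
  rw [hid' h4] at h2
  exact ⟨u', h2, h3⟩

lemma parent_of_views_eq (hid' : Function.Injective ident') {t : ℕ}
    (hview : (T.induce (T.ball v t)).map ident = (T'.induce (T'.ball v' t)).map ident')
    {u u' : V} (hu : u ∈ T.ball v t) (hw : T.parent u ∈ T.ball v t) (h : u ≠ T.root)
    (hu' : ident u = ident' u') : u' ≠ T'.root ∧ ident (T.parent u) = ident' (T'.parent u') := by
  have h1 : (ident u, ident (T.parent u)) ∈ ((T.induce (T.ball v t)).map ident).edges :=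
    mem_map_induce_edges.mpr ⟨u, hu, _, hw, T.isChild_parent h, rfl, rfl⟩
  rw [hview, mem_map_induce_edges] at h1
  obtain ⟨u'', -, w'', -, h2, h3, h4⟩ := h1
  rw [hu'] at h3
  rw [hid' h3] at h2
  exact ⟨h2.1, by rw [h2.2, h4]⟩

/-- Injective identifiers let edges be transferred between the two trees. Radius `m + 2` is needed
because the port of the `m`-th ancestor depends on its siblings, which are up to `m + 2` away from
`v`. -/
lemma sameAncestors_of_views_eq (hid : Function.Injective ident) (hid' : Function.Injective ident')
    (hview : (T.induce (T.ball v (m + 2))).map ident =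
      (T'.induce (T'.ball v' (m + 2))).map ident') (hv : ident v = ident' v') :
    T.SameAncestors δ ident T' ident' m v v' := by
  have hmem : ∀ j ≤ m + 2, T.parent^[j] v ∈ T.ball v (m + 2) :=
    fun j hj => T.ball_mono hj (T.iterate_parent_mem_ball v j)
  have hmem' : ∀ j ≤ m + 2, T'.parent^[j] v' ∈ T'.ball v' (m + 2) :=
    fun j hj => T'.ball_mono hj (T'.iterate_parent_mem_ball v' j)
  have hroot : ∀ j ≤ m + 1, ident (T.parent^[j] v) = ident' (T'.parent^[j] v') →
      (T.parent^[j] v = T.root ↔ T'.parent^[j] v' = T'.root) := by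
    intro j hj h
    rw [← not_iff_not]
    have h1 := hmem (j + 1) (by omega)
    have h2 := hmem' (j + 1) (by omega)
    rw [Function.iterate_succ_apply'] at h1 h2
    exact ⟨fun hne => (parent_of_views_eq hid' hview (hmem j (by omega)) h1 hne h).1,
      fun hne => (parent_of_views_eq hid hview.symm (hmem' j (by omega)) h2 hne h.symm).1⟩
  have hident : ∀ j ≤ m + 1, ident (T.parent^[j] v) = ident' (T'.parent^[j] v') := by
    intro j
    induction j with
    | zero => exact fun _ => hv
    | succ j ih =>
      intro hj
      have ihj := ih (by omega)
      by_cases h : T.parent^[j] v = T.root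
      · have h' := (hroot j (by omega) ihj).mp h
        rw [Function.iterate_succ_apply', Function.iterate_succ_apply', h, h', T.parent_root,
          T'.parent_root, ← h, ← h', ihj]
      · have h1 := hmem (j + 1) (by omega)
        rw [Function.iterate_succ_apply'] at h1 ⊢
        rw [Function.iterate_succ_apply']
        exact (parent_of_views_eq hid' hview (hmem j (by omega)) h1 h ihj).2
  intro j hj
  refine ⟨hident j (by omega), hroot j (by omega) (hident j (by omega)), ?_⟩
  have hp := hident (j + 1) (by omega)
  have hb := T.iterate_parent_mem_ball v (j + 1)
  have hb' := T'.iterate_parent_mem_ball v' (j + 1)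
  rw [Function.iterate_succ_apply'] at hb hb' hp
  rw [Function.iterate_succ_apply'] at hp
  unfold port
  rw [hident j (by omega)]
  congr! 5 with k
  constructor
  · rintro ⟨u, hu, rfl⟩
    exact isChild_of_views_eq hid' hview
      (T.ball_mono (by omega) (T.mem_ball_of_isChild hb (Or.inr hu)))
      (T.ball_mono (by omega) hb) hu hp
  · rintro ⟨u, hu, rfl⟩
    exact isChild_of_views_eq hid hview.symm
      (T'.ball_mono (by omega) (T'.mem_ball_of_isChild hb' (Or.inr hu)))
      (T'.ball_mono (by omega) hb') hu hp.symm

end SameAncestors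

end RootedTreeOn

/-! ### Switches and the labeling between them. -/

namespace RootedTreeOn

variable {V : Type*} (T : RootedTreeOn V) (ident : V → ℕ) (D L₁ L₂ : ℕ)

/-- The colors of `v` and its ancestors: two rounds of color reduction for the identifiers. -/
noncomputable def ancestorColor (v : V) : ℕ → ℕ :=
  reduceColors D L₂ (reduceColors D L₁ fun i => ident (T.parent^[i] v))

/-- `v` is a switch if its `D`-th ancestor has a color that is smaller than the colors of the `D`
nodes before and after it on the path to the root. -/
def IsSwitch (v : V) : Prop :=
  (∀ i < D, T.parent^[i] v ≠ T.root) ∧ ∀ l ≤ 2 * D, l ≠ D →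
    T.ancestorColor ident D L₁ L₂ v D < T.ancestorColor ident D L₁ L₂ v l

/-- Switches and the root. -/
def IsStop (v : V) : Prop :=
  T.IsSwitch ident D L₁ L₂ v ∨ v = T.root

variable {T ident D L₁ L₂}

lemma ancestorColor_iterate (v : V) (k i : ℕ) :
    T.ancestorColor ident D L₁ L₂ (T.parent^[k] v) i =
      T.ancestorColor ident D L₁ L₂ v (k + i) := by
  unfold ancestorColor
  have : (fun i => ident (T.parent^[i] (T.parent^[k] v))) =
      fun i => (fun i => ident (T.parent^[i] v)) (k + i) := by
    funext i
    rw [← Function.iterate_add_apply, add_comm]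
  rw [this, reduceColors_shift (x := fun i => ident (T.parent^[i] v)),
    reduceColors_shift (x := reduceColors D L₁ fun i => ident (T.parent^[i] v))]

/-- If `k ≤ D`, the two local minima lie in each other's windows, and each color would be strictly
smaller than the other. -/
lemma IsSwitch.lt_of_iterate {v : V} {k : ℕ} (h : T.IsSwitch ident D L₁ L₂ v) (hk : 0 < k)
    (h' : T.IsSwitch ident D L₁ L₂ (T.parent^[k] v)) : D < k := by
  by_contra! hkD
  have h1 := h.2 (D + k) (by omega) (by omega)
  have h2 := h'.2 (D - k) (by omega) (by omega)
  rw [ancestorColor_iterate, ancestorColor_iterate, show k + (D - k) = D by omega,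
    add_comm k D] at h2
  exact lt_asymm h1 h2

lemma IsSwitch.le_of_isStop {v : V} {k : ℕ} (h : T.IsSwitch ident D L₁ L₂ v) (hk : 0 < k)
    (h' : T.IsStop ident D L₁ L₂ (T.parent^[k] v)) : D ≤ k := by
  rcases h' with h' | h'
  · exact (h.lt_of_iterate hk h').le
  · by_contra! hlt
    exact h.1 k hlt h'

lemma exists_isStop_iterate (v : V) : ∃ k, T.IsStop ident D L₁ L₂ (T.parent^[k] v) := by
  obtain ⟨k, hk⟩ := T.reaches_root v
  exact ⟨k, Or.inr hk⟩

/-- There is a switch or the root within a short distance. -/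
lemma exists_le_isStop_iterate (hid : Function.Injective ident)
    (hL₁ : ∀ v, ident v < 2 ^ (L₁ + 1)) (hL₂ : (2 * (L₁ + 1)) ^ D ≤ 2 ^ (L₂ + 1)) (v : V) :
    ∃ k ≤ 2 * D * ((2 * (L₂ + 1)) ^ D + 1), T.IsStop ident D L₁ L₂ (T.parent^[k] v) := by
  set q := (2 * (L₂ + 1)) ^ D with hq
  set K := 2 * D * (q + 1) with hK
  by_cases hroot : ∃ k ≤ K, T.parent^[k] v = T.root
  · obtain ⟨k, hk, h⟩ := hroot
    exact ⟨k, hk, Or.inr h⟩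
  push Not at hroot
  have hne : ∀ i k, 0 < k → k ≤ D → i + k ≤ K →
      T.ancestorColor ident D L₁ L₂ v i ≠ T.ancestorColor ident D L₁ L₂ v (i + k) := by
    intro i k hk hkD hik
    refine reduceColors_ne ((reduceColors_lt _).trans_le hL₂) ((reduceColors_lt _).trans_le hL₂)
      (reduceColors_ne (hL₁ _) (hL₁ _) ?_ hk hkD) hk hkD
    exact fun h => T.iterate_parent_ne (show i < i + k by omega)
      (fun l hl => hroot l (by omega)) (hid h)
  have hlt : T.ancestorColor ident D L₁ L₂ v (D * q + D) < q := reduceColors_lt _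
  have hmul := Nat.mul_le_mul_left D hlt.le
  have hK' : K = D * q + D + D * q + D := by rw [hK]; ring
  -- The search starts in the middle of the `K` ancestors: its color is below `q`, so there is
  -- enough room on both sides.
  obtain ⟨j, hj, hjK, hmin⟩ := exists_isLocalMin hne _ (D * q + D) rfl (by omega) (by omega)
  -- The switch is placed `D` below the minimum, so that recognizing it requires looking only at
  -- ancestors.
  refine ⟨j - D, by omega, Or.inl ⟨fun i hi => ?_, fun l hl hlD => ?_⟩⟩
  · rw [← Function.iterate_add_apply]
    exact hroot _ (by omega)
  · rw [ancestorColor_iterate, ancestorColor_iterate, show j - D + D = j by omega]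
    exact hmin l hl hlD

variable (T ident D L₁ L₂)

open Classical in
/-- The distance to the nearest ancestor of `v` (or `v` itself) that is a switch or the root. -/
noncomputable def stopDist (v : V) : ℕ :=
  Nat.find (exists_isStop_iterate (T := T) (ident := ident) (D := D) (L₁ := L₁) (L₂ := L₂) v)

variable {T ident D L₁ L₂}

lemma isStop_stopDist (v : V) :
    T.IsStop ident D L₁ L₂ (T.parent^[T.stopDist ident D L₁ L₂ v] v) := by
  classical
  exact Nat.find_spec (exists_isStop_iterate v)

lemma stopDist_le {v : V} {k : ℕ} (h : T.IsStop ident D L₁ L₂ (T.parent^[k] v)) :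
    T.stopDist ident D L₁ L₂ v ≤ k := by
  classical
  exact Nat.find_le h

lemma stopDist_eq_zero {v : V} (h : T.IsStop ident D L₁ L₂ v) :
    T.stopDist ident D L₁ L₂ v = 0 :=
  Nat.le_zero.mp (stopDist_le (k := 0) h)

lemma stopDist_eq_succ {v : V} (h : ¬ T.IsStop ident D L₁ L₂ v) :
    T.stopDist ident D L₁ L₂ v = T.stopDist ident D L₁ L₂ (T.parent v) + 1 := by
  have h0 := isStop_stopDist (T := T) (ident := ident) (D := D) (L₁ := L₁) (L₂ := L₂) v
  have hpos : T.stopDist ident D L₁ L₂ v ≠ 0 := by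
    intro h'
    rw [h'] at h0
    exact h h0
  obtain ⟨k, hk⟩ := Nat.exists_eq_succ_of_ne_zero hpos
  rw [hk, Nat.succ_eq_add_one, Function.iterate_succ_apply] at h0
  refine le_antisymm (stopDist_le ?_) ?_
  · rw [Function.iterate_succ_apply]
    exact isStop_stopDist _
  · rw [hk]
    exact Nat.succ_le_succ (stopDist_le h0)

section Label

variable {δ : ℕ} [NeZero δ] {Γ : Type*} (F : Γ → List (Fin δ) → Γ) (a₀ : Γ)

variable (T ident D L₁ L₂)

open Classical in
/-- The label of a switch, or of the root. -/
noncomputable def stopLabel (v : V) : Γ :=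
  if v = T.root then a₀
  -- `a₀` stands in for the true label of the stop above, whose computation would start a chain up
  -- to the root. At depth `D` or more the choice makes no difference.
  else F a₀ (T.portPath δ ident (T.stopDist ident D L₁ L₂ (T.parent v) + 1) v)

/-- The label of a node: continue the labeling `F` from the nearest switch above. -/
noncomputable def label (v : V) : Γ :=
  F (T.stopLabel ident D L₁ L₂ F a₀ (T.parent^[T.stopDist ident D L₁ L₂ v] v))
    (T.portPath δ ident (T.stopDist ident D L₁ L₂ v) v)

variable {T ident D L₁ L₂ F a₀}

/-- The labels around `v` all agree with one labeling `F a`, where `a` is the label of the nearest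
stop above, and this labeling is correct everywhere. A child that is itself a switch fits too,
because it lies at depth at least `D` below that stop. -/
lemma isSolution_label (hT : T.IsRegular δ) (hid : Function.Injective ident)
    {P : RootedTreeLCL δ Γ} {W : Set Γ} (ha₀ : a₀ ∈ W)
    (hF : ∀ a ∈ W, F a [] = a ∧ ∀ x, P.AllowedAt (F a) x)
    (hFW : ∀ a ∈ W, ∀ x : List (Fin δ), D ≤ x.length → F a x ∈ W)
    (hFF : ∀ a ∈ W, ∀ b ∈ W, ∀ x : List (Fin δ), D ≤ x.length → F a x = F b x) :
    P.IsSolution T (T.label ident D L₁ L₂ F a₀) := by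
  have hlen : ∀ v, T.IsSwitch ident D L₁ L₂ v →
      D ≤ T.stopDist ident D L₁ L₂ (T.parent v) + 1 := by
    intro v hv
    refine hv.le_of_isStop (Nat.succ_pos _) ?_
    rw [Function.iterate_succ_apply]
    exact isStop_stopDist _
  have hmemW : ∀ v, T.IsStop ident D L₁ L₂ v → T.stopLabel ident D L₁ L₂ F a₀ v ∈ W := by
    intro v hv
    unfold stopLabel
    split_ifs with h
    · exact ha₀
    · refine hFW a₀ ha₀ _ ?_
      rw [length_portPath]
      exact hlen v (hv.resolve_right h)
  have hchild : ∀ u v, T.IsChild u v → T.label ident D L₁ L₂ F a₀ u =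
      F (T.stopLabel ident D L₁ L₂ F a₀ (T.parent^[T.stopDist ident D L₁ L₂ v] v))
        (T.portPath δ ident (T.stopDist ident D L₁ L₂ v) v ++ [T.port δ ident u]) := by
    rintro u v ⟨hu, rfl⟩
    by_cases hs : T.IsStop ident D L₁ L₂ u
    · have hsw : T.IsSwitch ident D L₁ L₂ u := hs.resolve_right hu
      unfold label
      simp only [stopDist_eq_zero hs, Function.iterate_zero_apply, portPath]
      rw [(hF _ (hmemW u hs)).1, stopLabel, if_neg hu, portPath]
      refine hFF _ ha₀ _ (hmemW _ (isStop_stopDist _)) _ ?_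
      have := hlen u hsw
      rw [List.length_append, length_portPath]
      exact this
    · unfold label
      rw [stopDist_eq_succ hs, Function.iterate_succ_apply, portPath]
  intro v hv
  obtain ⟨e, he⟩ := exists_equiv_port hT hid hv
  obtain ⟨π, hπ⟩ := (hF _ (hmemW _ (isStop_stopDist v))).2
    (T.portPath δ ident (T.stopDist ident D L₁ L₂ v) v)
  refine ⟨π.trans e, ?_⟩
  convert hπ using 2
  · rfl
  funext i
  rw [hchild _ v ((π.trans e) i).2]
  simp [he]

end Label

section Locality

variable {δ : ℕ} [NeZero δ] {T' : RootedTreeOn V} {ident' : V → ℕ} {m : ℕ} {v v' : V}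

/-- A switch inspects colors up to index `2 * D`, and each of the two reduction rounds looks `D`
steps further. -/
lemma SameAncestors.isStop_iff
    (h : T.SameAncestors δ ident T' ident' (4 * D) v v') :
    T.IsStop ident D L₁ L₂ v ↔ T'.IsStop ident' D L₁ L₂ v' := by
  have hcol : ∀ l ≤ 2 * D, T.ancestorColor ident D L₁ L₂ v l =
      T'.ancestorColor ident' D L₁ L₂ v' l := fun l hl =>
    reduceColors_congr fun i hi => reduceColors_congr fun j hj => (h _ (by omega)).1
  unfold IsStop IsSwitch
  refine or_congr (and_congr ?_ ?_) (h 0 (Nat.zero_le _)).2.1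
  · exact forall₂_congr fun i hi => not_congr (h i (by omega)).2.1
  · refine forall₃_congr fun l hl _ => ?_
    rw [hcol l hl, hcol D (by omega)]

lemma SameAncestors.stopDist_eq {K : ℕ}
    (h : T.SameAncestors δ ident T' ident' (4 * D + K) v v')
    (hK : T.stopDist ident D L₁ L₂ v ≤ K) (hK' : T'.stopDist ident' D L₁ L₂ v' ≤ K) :
    T.stopDist ident D L₁ L₂ v = T'.stopDist ident' D L₁ L₂ v' := by
  have hiff : ∀ k ≤ K, (T.IsStop ident D L₁ L₂ (T.parent^[k] v) ↔
      T'.IsStop ident' D L₁ L₂ (T'.parent^[k] v')) := fun k hk =>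
    ((h.mono (show 4 * D + k ≤ 4 * D + K by omega)).iterate).isStop_iff
  exact le_antisymm (stopDist_le ((hiff _ hK').mpr (isStop_stopDist _)))
    (stopDist_le ((hiff _ hK).mp (isStop_stopDist _)))

/-- The label needs the nearest stop (`K` steps), the parent of that stop (one step), the next stop
above (`K` steps), and `4 * D` steps to recognize stops. -/
lemma SameAncestors.label_eq {Γ : Type*} (F : Γ → List (Fin δ) → Γ) (a₀ : Γ) {K : ℕ}
    (hK : ∀ v, T.stopDist ident D L₁ L₂ v ≤ K) (hK' : ∀ v, T'.stopDist ident' D L₁ L₂ v ≤ K)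
    (h : T.SameAncestors δ ident T' ident' (4 * D + 2 * K + 1) v v') :
    T.label ident D L₁ L₂ F a₀ v = T'.label ident' D L₁ L₂ F a₀ v' := by
  have h1 := SameAncestors.stopDist_eq (h.mono (k := 4 * D + K) (by omega)) (hK v) (hK' v')
  unfold label
  rw [← h1]
  set k := T.stopDist ident D L₁ L₂ v with hk
  have hkK : k ≤ K := hK v
  rw [SameAncestors.portPath_eq (h.mono (k := k) (by omega))]
  congr 1
  have h2 : T.SameAncestors δ ident T' ident' (4 * D + K + 1) (T.parent^[k] v)
      (T'.parent^[k] v') := (h.mono (by omega)).iterate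
  set s := T.parent^[k] v
  set s' := T'.parent^[k] v'
  have hp : T.SameAncestors δ ident T' ident' (4 * D + K) (T.parent s) (T'.parent s') :=
    h2.iterate (k := 1)
  have h3 := hp.stopDist_eq (hK (T.parent s)) (hK' (T'.parent s'))
  unfold stopLabel
  rw [← h3, SameAncestors.portPath_eq (h2.mono _)]
  · have hroot : s = T.root ↔ s' = T'.root := (h2 0 (Nat.zero_le _)).2.1
    by_cases hs : s = T.root
    · rw [if_pos hs, if_pos (hroot.mp hs)]
    · rw [if_neg hs, if_neg (mt hroot.mpr hs)]
  · have := hK (T.parent s)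
    omega

end Locality

end RootedTreeOn

/-! ### The LOCAL algorithm obtained from a certificate. -/

namespace RootedTreeLCL

/-- The LOCAL algorithm for problems with a certificate. -/
theorem HasCertificate.exists_localSolvable {δ : ℕ} [NeZero δ] {Γ : Type*} [Finite Γ]
    {P : RootedTreeLCL δ Γ} (h : P.HasCertificate) :
    ∃ D : ℕ, ∀ M n L₁ L₂ : ℕ, M < 2 ^ (L₁ + 1) → (2 * (L₁ + 1)) ^ D ≤ 2 ^ (L₂ + 1) →
      P.LocalSolvable M n (4 * D + 2 * (2 * D * ((2 * (L₂ + 1)) ^ D + 1)) + 3) := by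
  obtain ⟨W, D, F, ⟨a₀, ha₀⟩, hF, hFW, hFF⟩ := h.exists_labelings
  refine ⟨D, fun M n L₁ L₂ hL₁ hL₂ => ?_⟩
  have : Nonempty Γ := ⟨a₀⟩
  set K := 2 * D * ((2 * (L₂ + 1)) ^ D + 1) with hK
  -- The algorithm imagines any tree with the given view and outputs the label there; by locality of
  -- `label` all such trees give the same answer.
  let Is (g : TreePiece ℕ) (k : ℕ) (a : Γ) : Prop := ∃ (T : RootedTreeOn (Fin n))
    (ident : Fin n → ℕ) (v : Fin n), Function.Injective ident ∧
      (∀ v, ident v ∈ Set.Icc 1 M) ∧ (T.induce (T.ball v (4 * D + 2 * K + 3))).map ident = g ∧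
      ident v = k ∧ T.label ident D L₁ L₂ F a₀ v = a
  refine ⟨fun g k => Classical.epsilon (Is g k), fun T hT ident hid hIcc => ?_⟩
  convert RootedTreeOn.isSolution_label (T := T) (ident := ident) (L₁ := L₁) (L₂ := L₂) hT hid
    ha₀ hF hFW hFF using 1
  funext v
  have hex : ∃ a, Is ((T.induce (T.ball v (4 * D + 2 * K + 3))).map ident) (ident v) a :=
    ⟨_, T, ident, v, hid, hIcc, rfl, rfl, rfl⟩
  obtain ⟨T', ident', v', hid', hIcc', hview, hv, hlab⟩ := Classical.epsilon_spec hex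
  beta_reduce
  rw [← hlab]
  have hdist : ∀ (T : RootedTreeOn (Fin n)) (ident : Fin n → ℕ), Function.Injective ident →
      (∀ v, ident v ∈ Set.Icc 1 M) → ∀ v, T.stopDist ident D L₁ L₂ v ≤ K := by
    intro T ident hid hIcc v
    obtain ⟨k, hk, hs⟩ := RootedTreeOn.exists_le_isStop_iterate (T := T) hid
      (fun v => (hIcc v).2.trans_lt hL₁) hL₂ v
    exact (RootedTreeOn.stopDist_le hs).trans hk
  exact RootedTreeOn.SameAncestors.label_eq F a₀ (hdist T' ident' hid' hIcc')
    (hdist T ident hid hIcc) (RootedTreeOn.sameAncestors_of_views_eq hid' hid hview hv)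

end RootedTreeLCL

/-! ### The locality bound is o(log n). -/

/-- The locality of the LOCAL algorithm for identifiers with `L + 1` bits. -/
def localityBound (D L : ℕ) : ℕ :=
  4 * D + 2 * (2 * D * ((2 * (Nat.log 2 ((2 * (L + 1)) ^ D) + 1)) ^ D + 1)) + 3

lemma natLog_two_isBigO (D : ℕ) :
    (fun L : ℕ => (Nat.log 2 ((2 * (L + 1)) ^ D) : ℝ)) =O[atTop] fun L : ℕ => Real.log L := by
  refine IsBigO.of_bound (3 * D / Real.log 2) ?_
  filter_upwards [eventually_ge_atTop 2] with L hL
  have hlog2 : 0 < Real.log 2 := Real.log_pos one_lt_two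
  have hlogL : 0 ≤ Real.log L := Real.log_natCast_nonneg L
  have h1 : (2 * ((L : ℝ) + 1)) ≤ (L : ℝ) ^ 3 := by
    have : (2 : ℝ) ≤ L := by exact_mod_cast hL
    nlinarith [mul_self_nonneg ((L : ℝ) - 2)]
  have h2 : Real.log (2 * ((L : ℝ) + 1)) ≤ 3 * Real.log L := by
    have := Real.log_le_log (by positivity) h1
    rwa [Real.log_pow] at this
  rw [Real.norm_of_nonneg (Nat.cast_nonneg _), Real.norm_of_nonneg hlogL]
  have h3 := Real.natLog_le_logb ((2 * (L + 1)) ^ D) 2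
  refine h3.trans ?_
  unfold Real.logb
  push_cast
  rw [Real.log_pow, div_mul_eq_mul_div]
  refine div_le_div_of_nonneg_right ?_ hlog2.le
  calc (D : ℝ) * Real.log (2 * ((L : ℝ) + 1)) ≤ D * (3 * Real.log L) := by gcongr
    _ = 3 * D * Real.log L := by ring

/-- After two rounds the number of colors is polylogarithmic in `L`, hence so is the bound. A single
round would leave a power of `L`, which need not be o(L). -/
lemma localityBound_isLittleO (D : ℕ) :
    (fun L : ℕ => (localityBound D L : ℝ)) =o[atTop] fun L : ℕ => (L : ℝ) := by
  have hcast : Tendsto (fun L : ℕ => (L : ℝ)) atTop atTop := tendsto_natCast_atTop_atTop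
  have hconst : ∀ a : ℝ, (fun _ : ℕ => a) =o[atTop] fun L : ℕ => (L : ℝ) := fun a =>
    isLittleO_const_left.mpr (Or.inr (tendsto_norm_atTop_atTop.comp hcast))
  have hone : (fun _ : ℕ => (1 : ℝ)) =O[atTop] fun L : ℕ => Real.log L :=
    ((isLittleO_const_left (c := (1 : ℝ))).mpr (Or.inr (tendsto_norm_atTop_atTop.comp
      (Real.tendsto_log_atTop.comp hcast)))).isBigO
  have hpow : (fun L : ℕ => (2 * ((Nat.log 2 ((2 * (L + 1)) ^ D) : ℝ) + 1)) ^ D) =o[atTop]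
      fun L : ℕ => (L : ℝ) :=
    ((((natLog_two_isBigO D).add hone).const_mul_left 2).pow D).trans_isLittleO
      (Real.isLittleO_pow_log_id_atTop.comp_tendsto hcast)
  have := ((hconst (4 * D)).add (((hpow.add (hconst 1)).const_mul_left (2 * D)).const_mul_left
    2)).add (hconst 3)
  refine this.congr_left fun L => ?_
  unfold localityBound
  push_cast
  ring

lemma natLog_tendsto {M : ℕ → ℕ} (hM : ∀ n, n ≤ M n) :
    Tendsto (fun n => Nat.log 2 (M n)) atTop atTop := by
  refine tendsto_atTop.mpr fun b => ?_
  filter_upwards [eventually_ge_atTop (2 ^ b)] with n hn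
  exact Nat.le_log_of_pow_le one_lt_two (hn.trans (hM n))

lemma natLog_isBigO {M : ℕ → ℕ} (hM : ∀ n, n ≤ M n)
    (hMpoly : ∃ k : ℕ, (fun n : ℕ => (M n : ℝ)) =O[atTop] fun n : ℕ => (n : ℝ) ^ k) :
    (fun n => (Nat.log 2 (M n) : ℝ)) =O[atTop] fun n : ℕ => Real.log n := by
  obtain ⟨k, hk⟩ := hMpoly
  obtain ⟨C, hC, hbound⟩ := hk.exists_pos
  have hlogC : (fun _ : ℕ => Real.log C) =O[atTop] fun n : ℕ => Real.log n :=
    (isLittleO_const_left.mpr (Or.inr (tendsto_norm_atTop_atTop.comp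
      (Real.tendsto_log_atTop.comp tendsto_natCast_atTop_atTop)))).isBigO
  have hsum : (fun n : ℕ => (Real.log C + k * Real.log n) / Real.log 2) =O[atTop]
      fun n : ℕ => Real.log n := by
    simp only [div_eq_inv_mul]
    exact (hlogC.add ((isBigO_refl _ _).const_mul_left _)).const_mul_left _
  refine IsBigO.trans (IsBigO.of_bound 1 ?_) hsum
  filter_upwards [hbound.bound, eventually_ge_atTop 1] with n hn hn1
  have hn0 : (0 : ℝ) < n := by exact_mod_cast hn1
  have hM0 : (0 : ℝ) < M n := by exact_mod_cast hn1.trans (hM n)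
  rw [Real.norm_of_nonneg (Nat.cast_nonneg _), Real.norm_of_nonneg (by positivity)] at hn
  rw [Real.norm_of_nonneg (Nat.cast_nonneg _), one_mul]
  refine le_trans ?_ (le_abs_self _)
  refine (Real.natLog_le_logb _ _).trans ?_
  unfold Real.logb
  push_cast
  have := Real.log_le_log hM0 hn
  rw [Real.log_mul hC.ne' (by positivity), Real.log_pow] at this
  have hlog2 : 0 < Real.log 2 := Real.log_pos one_lt_two
  gcongr

namespace RootedTreeLCL

/-- Polynomially bounded identifiers have O(log n) bits, so the algorithm has locality o(log n).
Arbitrarily large instances are required, as the Ω-bound says nothing about other `n`. -/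
theorem HasCertificate.not_isOmegaLog {δ : ℕ} [NeZero δ] {Γ : Type*} [Finite Γ]
    {P : RootedTreeLCL δ Γ} (h : P.HasCertificate) {M : ℕ → ℕ} (hM : ∀ n, n ≤ M n)
    (hMpoly : ∃ k : ℕ, (fun n : ℕ => (M n : ℝ)) =O[atTop] fun n : ℕ => (n : ℝ) ^ k)
    (hinst : ∀ n₀, ∃ n ≥ n₀, ∃ T : RootedTreeOn (Fin n), T.IsRegular δ) :
    ¬ IsOmegaLog δ (P.localLocality M) := by
  rintro ⟨c, hc, n₀, hΩ⟩
  obtain ⟨D, hD⟩ := h.exists_localSolvable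
  have hsmall : (fun n : ℕ => (localityBound D (Nat.log 2 (M n)) : ℝ)) =o[atTop]
      fun n : ℕ => Real.log n :=
    ((localityBound_isLittleO D).comp_tendsto (natLog_tendsto hM)).trans_isBigO
      (natLog_isBigO hM hMpoly)
  have hev := hsmall.bound (show 0 < c / 2 by positivity)
  obtain ⟨n₁, hn₁⟩ := eventually_atTop.mp hev
  obtain ⟨n, hn, hT⟩ := hinst (max (max n₀ n₁) 2)
  have hn0 : n₀ ≤ n := le_trans (by simp) hn
  have hn1 : n₁ ≤ n := le_trans (by simp) hn
  have hn2 : 2 ≤ n := le_trans (by simp) hn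
  have hlog : 0 < Real.log n := Real.log_pos (by exact_mod_cast hn2)
  have h1 := hn₁ n hn1
  rw [Real.norm_of_nonneg (Nat.cast_nonneg _), Real.norm_of_nonneg hlog.le] at h1
  have hsolv : P.LocalSolvable (M n) n (localityBound D (Nat.log 2 (M n))) :=
    hD (M n) n _ _ (Nat.lt_pow_succ_log_self one_lt_two _)
      (Nat.lt_pow_succ_log_self one_lt_two _).le
  have h2 : P.localLocality M n ≤ (localityBound D (Nat.log 2 (M n)) : ℕ∞) :=
    iInf₂_le _ hsolv
  have h3 := (hΩ n hn0 hT).trans (ENat.toENNReal_le.mpr h2)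
  rw [ENat.toENNReal_coe, ← ENNReal.ofReal_natCast,
    ENNReal.ofReal_le_ofReal_iff (Nat.cast_nonneg _)] at h3
  nlinarith

end RootedTreeLCL

/-! ### Rearranging subtrees. -/

namespace RootedTreeOn

variable {V : Type*} (T : RootedTreeOn V)

open Classical in
/-- The distance to the root. -/
noncomputable def depth (v : V) : ℕ :=
  Nat.find (T.reaches_root v)

lemma depth_root : T.depth T.root = 0 := by
  simp [depth]

lemma depth_eq_succ {v : V} (hv : v ≠ T.root) : T.depth v = T.depth (T.parent v) + 1 := by
  classical
  unfold depth
  rw [Nat.find_eq_iff]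
  refine ⟨Nat.find_spec (T.reaches_root (T.parent v)), fun k hk => ?_⟩
  rcases k with - | k
  · exact hv
  · rw [Function.iterate_succ_apply]
    exact Nat.find_min (T.reaches_root (T.parent v)) (Nat.lt_of_succ_lt_succ hk)

lemma IsChild.depth_eq {T : RootedTreeOn V} {u v : V} (h : T.IsChild u v) :
    T.depth u = T.depth v + 1 := by
  rw [T.depth_eq_succ h.1, h.2]

section Rewire

/-- Rearrange the subtrees of `T`: the node `ρ v` of `T` is replaced by `v` as a child. -/
def rewire (ρ : Equiv.Perm V) (hroot : ρ T.root = T.root)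
    (hreach : ∀ v, ∃ k : ℕ, (T.parent ∘ ρ)^[k] v = T.root) : RootedTreeOn V where
  root := T.root
  parent := T.parent ∘ ρ
  parent_root := by simp [hroot, T.parent_root]
  reaches_root := hreach

variable {T} {ρ : Equiv.Perm V} {hroot : ρ T.root = T.root}
  {hreach : ∀ v, ∃ k : ℕ, (T.parent ∘ ρ)^[k] v = T.root}

lemma isChild_rewire {u v : V} : (T.rewire ρ hroot hreach).IsChild u v ↔ T.IsChild (ρ u) v := by
  refine and_congr (not_congr ?_) Iff.rfl
  change u = T.root ↔ _
  conv_rhs => rw [← hroot, ρ.injective.eq_iff]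

lemma isLeaf_rewire {v : V} : (T.rewire ρ hroot hreach).IsLeaf v ↔ T.IsLeaf v := by
  unfold IsLeaf
  simp only [isChild_rewire]
  exact ρ.forall_congr_right (q := fun u => ¬ T.IsChild u v)

lemma IsRegular.rewire {δ : ℕ} (h : T.IsRegular δ) : (T.rewire ρ hroot hreach).IsRegular δ := by
  intro v hv
  obtain ⟨e⟩ := h v (by rwa [isLeaf_rewire] at hv)
  exact ⟨e.trans (ρ.subtypeEquiv fun _ => isChild_rewire).symm⟩

/-- Nodes from an antichain can be permuted. -/
lemma reaches_root_of_antichain {ρ : Equiv.Perm V}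
    (h : ∀ v, ρ v ≠ v → ∀ k, ρ (T.parent^[k + 1] v) = T.parent^[k + 1] v) (v : V) :
    ∃ k : ℕ, (T.parent ∘ ρ)^[k] v = T.root := by
  have hfix : ∀ v, (∀ k, ρ (T.parent^[k] v) = T.parent^[k] v) →
      ∃ k : ℕ, (T.parent ∘ ρ)^[k] v = T.root := by
    intro v hv
    obtain ⟨k, hk⟩ := T.reaches_root v
    refine ⟨k, ?_⟩
    rw [← hk]
    clear hk
    induction k with
    | zero => rfl
    | succ k ih => rw [Function.iterate_succ_apply', ih, Function.iterate_succ_apply',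
        Function.comp_apply, hv]
  have hind : ∀ d v, T.depth v = d → ∃ k : ℕ, (T.parent ∘ ρ)^[k] v = T.root := by
    intro d
    induction d with
    | zero =>
      intro v hv
      refine ⟨0, ?_⟩
      by_contra hne
      rw [Function.iterate_zero_apply] at hne
      rw [T.depth_eq_succ hne] at hv
      omega
    | succ d ih =>
      intro v hv
      have hnext : ∃ k : ℕ, (T.parent ∘ ρ)^[k] (T.parent (ρ v)) = T.root := by
        by_cases hv' : ρ v = v
        · rw [hv']
          refine ih _ ?_
          have hne : v ≠ T.root := by
            rintro rfl
            rw [T.depth_root] at hv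
            omega
          rw [T.depth_eq_succ hne] at hv
          omega
        -- After a step through a moved node, the walk is strictly above `ρ v`, where nothing is
        -- moved, so it continues as in `T`.
        · refine hfix _ fun k => ?_
          have := h (ρ v) (fun h' => hv' (ρ.injective h')) k
          rwa [Function.iterate_succ_apply] at this
      obtain ⟨k, hk⟩ := hnext
      exact ⟨k + 1, hk⟩
  exact hind _ v rfl

lemma reaches_root_of_rank {r : V} {p : V → V} (rank : V → ℕ)
    (h : ∀ v, v ≠ r → rank (p v) < rank v) (v : V) : ∃ k : ℕ, p^[k] v = r := by
  induction hn : rank v using Nat.strong_induction_on generalizing v with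
  | _ n ih =>
    by_cases hv : v = r
    · exact ⟨0, hv⟩
    · obtain ⟨k, hk⟩ := ih _ (hn ▸ h v hv) (p v) rfl
      exact ⟨k + 1, hk⟩

end Rewire

/-- Balls inside a region where two trees agree. -/
lemma ball_eq_of_agree {T T' : RootedTreeOn V} {U : ℕ → Set V} {t : ℕ} {v : V} (hv : v ∈ U 0)
    (hmono : ∀ s, U s ⊆ U (s + 1))
    (hstep : ∀ s, ∀ x ∈ U s, ∀ y, T.graph.Adj x y → y ∈ U (s + 1))
    (hagree : ∀ x y, x ∈ U t ∨ y ∈ U t → (T.IsChild x y ↔ T'.IsChild x y)) :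
    ∀ s ≤ t, T.ball v s ⊆ U s ∧ T.ball v s = T'.ball v s := by
  have hmono' : Monotone U := monotone_nat_of_le_succ hmono
  intro s
  induction s with
  | zero =>
    intro _
    rw [ball_zero, ball_zero]
    exact ⟨by simpa using hv, rfl⟩
  | succ s ih =>
    intro hs
    obtain ⟨h1, h2⟩ := ih (by omega)
    constructor
    · intro x hx
      rcases T.mem_ball_succ.mp hx with hx | ⟨z, hz, hadj⟩
      · exact hmono s (h1 hx)
      · exact hstep s z (h1 hz) x hadj
    · ext x
      rw [mem_ball_succ, mem_ball_succ, ← h2]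
      refine or_congr Iff.rfl (exists_congr fun z => and_congr_right fun hz => ?_)
      have hzU : z ∈ U t := hmono' (by omega) (h1 hz)
      rw [adj_iff, adj_iff, hagree z x (Or.inl hzU), hagree x z (Or.inr hzU)]

/-- Only edges between a moved node and a parent of a moved node change, and all their endpoints
avoid `U`. -/
lemma isChild_rewire_iff_of_notMem {T : RootedTreeOn V} {ρ : Equiv.Perm V}
    {hroot : ρ T.root = T.root} {hreach : ∀ v, ∃ k : ℕ, (T.parent ∘ ρ)^[k] v = T.root} {U : Set V}
    (h : ∀ v, ρ v ≠ v → v ∉ U ∧ T.parent v ∉ U) {x y : V} (hxy : x ∈ U ∨ y ∈ U) :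
    T.IsChild x y ↔ (T.rewire ρ hroot hreach).IsChild x y := by
  rw [isChild_rewire]
  by_cases hx : ρ x = x
  · rw [hx]
  · have h1 := h x hx
    have h2 := h (ρ x) (fun h' => hx (ρ.injective h'))
    have hy := hxy.resolve_left h1.1
    constructor
    · rintro ⟨-, rfl⟩
      exact absurd hy h1.2
    · rintro ⟨-, rfl⟩
      exact absurd hy h2.2

end RootedTreeOn

/-! ### Adversaries that present hidden regions late. -/

namespace RootedTreeLCL

variable {δ : ℕ} {Γ : Type*}

/-- If two trees agree in a region that contains the radius-`t` balls of the nodes that are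
presented first, then these nodes get the same labels in both trees. -/
lemma onlineOutput_eq_of_agree {n t : ℕ} (A : TreePiece (Fin n) → List (Fin n) → Γ)
    {T T' : RootedTreeOn (Fin n)} {σ : Equiv.Perm (Fin n)} {U : ℕ → Set (Fin n)}
    (hσ : ∀ v ∈ U 0, ∀ j ≤ σ.symm v, σ j ∈ U 0)
    (hmono : ∀ s, U s ⊆ U (s + 1))
    (hstep : ∀ s, ∀ x ∈ U s, ∀ y, T.graph.Adj x y → y ∈ U (s + 1))
    (hagree : ∀ x y, x ∈ U t ∨ y ∈ U t → (T.IsChild x y ↔ T'.IsChild x y))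
    {v : Fin n} (hv : v ∈ U 0) : onlineOutput A t T σ v = onlineOutput A t T' σ v := by
  have hball : ∀ u ∈ U 0, T.ball u t ⊆ U t ∧ T.ball u t = T'.ball u t := fun u hu =>
    RootedTreeOn.ball_eq_of_agree hu hmono hstep hagree t le_rfl
  have hunion : (⋃ j ∈ Set.Iic (σ.symm v), T'.ball (σ j) t) =
      ⋃ j ∈ Set.Iic (σ.symm v), T.ball (σ j) t :=
    Set.iUnion₂_congr fun j hj => (hball _ (hσ v hv j hj)).2.symm
  have hsub : (⋃ j ∈ Set.Iic (σ.symm v), T.ball (σ j) t) ⊆ U t :=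
    Set.iUnion₂_subset fun j hj => (hball _ (hσ v hv j hj)).1
  unfold onlineOutput
  rw [hunion]
  congr 1
  unfold RootedTreeOn.induce
  congr 1
  ext e
  exact and_congr_right fun h1 => and_congr_right fun _ => hagree _ _ (Or.inl (hsub h1))

/-- The nodes of a given set can be presented first. -/
lemma exists_perm_presenting {n : ℕ} (Q : Set (Fin n)) :
    ∃ σ : Equiv.Perm (Fin n), ∀ v ∈ Q, ∀ j ≤ σ.symm v, σ j ∈ Q := by
  classical
  let f : Fin n → ℕ := fun v => if v ∈ Q then 0 else 1
  refine ⟨Tuple.sort f, fun v hv j hj => ?_⟩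
  have h := Tuple.monotone_sort f hj
  simp only [Function.comp_apply, Equiv.apply_symm_apply, f, if_pos hv] at h
  by_contra hne
  rw [if_neg hne] at h
  omega

end RootedTreeLCL

/-- A permutation that exchanges the values of two families. -/
lemma exists_perm_exchanging {X V : Type*} {f h : X → V} (hf : Function.Injective f)
    (hh : Function.Injective h) (hfh : ∀ x y, f x ≠ h y) :
    ∃ ρ : Equiv.Perm V, (∀ x, ρ (f x) = h x) ∧ (∀ x, ρ (h x) = f x) ∧
      ∀ v, ρ v ≠ v → ∃ x, v = f x ∨ v = h x := by
  classical
  let s : V → V := fun v => if hv : ∃ x, f x = v then h hv.choose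
    else if hv : ∃ x, h x = v then f hv.choose else v
  have hsf : ∀ x, s (f x) = h x := by
    intro x
    have hex : ∃ y, f y = f x := ⟨x, rfl⟩
    simp only [s, dif_pos hex]
    rw [hf hex.choose_spec]
  have hsh : ∀ x, s (h x) = f x := by
    intro x
    have hex : ∃ y, h y = h x := ⟨x, rfl⟩
    have hnex : ¬ ∃ y, f y = h x := fun ⟨y, hy⟩ => hfh y x hy
    simp only [s, dif_neg hnex, dif_pos hex]
    rw [hh hex.choose_spec]
  have hs : ∀ v, s v ≠ v → ∃ x, v = f x ∨ v = h x := by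
    intro v hv
    by_contra! hcon
    refine hv ?_
    simp only [s]
    rw [dif_neg fun ⟨x, hx⟩ => (hcon x).1 hx.symm, dif_neg fun ⟨x, hx⟩ => (hcon x).2 hx.symm]
  have hinv : Function.Involutive s := by
    intro v
    by_cases hv : s v = v
    · rw [hv, hv]
    · obtain ⟨x, rfl | rfl⟩ := hs v hv
      · rw [hsf, hsh]
      · rw [hsh, hsf]
  exact ⟨hinv.toPerm s, hsf, hsh, hs⟩

/-! ### The heap-ordered tree as a concrete instance. -/

section Heap

/-- As `δ` divides `n - 1`, the non-root nodes split into full blocks of siblings, so a node with a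
first child has all of them. -/
lemma heap_children_lt {δ n m : ℕ} (hn : n = 1 + δ * m) {k : ℕ} (h : δ * k + 1 < n) (i : Fin δ) :
    δ * k + 1 + i < n := by
  have hkm : k < m := by
    by_contra! hle
    have := Nat.mul_le_mul_left δ hle
    omega
  have h1 := Nat.mul_le_mul_left δ (Nat.succ_le_of_lt hkm)
  have h2 := i.2
  rw [Nat.mul_succ] at h1
  omega

variable (δ n : ℕ) [NeZero n]

/-- The tree with node set `{0, …, n - 1}` where the children of `v` are
`δ * v + 1, …, δ * v + δ`. -/
def heap : RootedTreeOn (Fin n) where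
  root := 0
  parent v := ⟨(v - 1) / δ, (Nat.div_le_self _ _).trans_lt (by have := v.2; omega)⟩
  parent_root := by ext; simp
  reaches_root := by
    refine RootedTreeOn.reaches_root_of_rank (fun v => (v : ℕ)) fun v hv => ?_
    have : (v : ℕ) ≠ 0 := fun h => hv (Fin.ext (by simpa using h))
    exact (Nat.div_le_self _ _).trans_lt (by omega)

variable {δ n}

lemma heap_isChild (hδ : 0 < δ) {u v : Fin n} :
    (heap δ n).IsChild u v ↔ ∃ i : Fin δ, (u : ℕ) = δ * v + 1 + i := by
  have hroot : u = (heap δ n).root ↔ (u : ℕ) = 0 := by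
    rw [Fin.ext_iff]
    simp [heap]
  have hpar : (heap δ n).parent u = v ↔ ((u : ℕ) - 1) / δ = v := by
    rw [Fin.ext_iff]
    rfl
  unfold RootedTreeOn.IsChild
  rw [Ne, hroot, hpar]
  constructor
  · rintro ⟨h0, h⟩
    refine ⟨⟨((u : ℕ) - 1) % δ, Nat.mod_lt _ hδ⟩, ?_⟩
    have := Nat.div_add_mod ((u : ℕ) - 1) δ
    rw [h] at this
    simp only
    omega
  · rintro ⟨i, hi⟩
    refine ⟨by omega, ?_⟩
    rw [hi, show δ * (v : ℕ) + 1 + i - 1 = i + δ * v by omega, Nat.add_mul_div_left _ _ hδ,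
      Nat.div_eq_of_lt i.2, zero_add]

/-- The children of a node, in their order. -/
lemma heap_exists_equiv (hδ : 0 < δ) {m : ℕ} (hn : n = 1 + δ * m) {v : Fin n}
    (hv : δ * (v : ℕ) + 1 < n) :
    ∃ e : Fin δ ≃ {u // (heap δ n).IsChild u v}, ∀ i, ((e i : Fin n) : ℕ) = δ * v + 1 + i := by
  let f : Fin δ → {u // (heap δ n).IsChild u v} := fun i =>
    ⟨⟨δ * v + 1 + i, heap_children_lt hn hv i⟩, (heap_isChild hδ).mpr ⟨i, rfl⟩⟩
  have hf : Function.Bijective f := by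
    constructor
    · intro i j h
      have := congrArg Fin.val (congrArg Subtype.val h)
      simp only [f] at this
      exact Fin.ext (by omega)
    · rintro ⟨u, hu⟩
      obtain ⟨i, hi⟩ := (heap_isChild hδ).mp hu
      exact ⟨i, Subtype.ext (Fin.ext hi.symm)⟩
  exact ⟨Equiv.ofBijective f hf, fun i => rfl⟩

lemma heap_not_isLeaf_iff (hδ : 0 < δ) {v : Fin n} :
    ¬ (heap δ n).IsLeaf v ↔ δ * (v : ℕ) + 1 < n := by
  unfold RootedTreeOn.IsLeaf
  push Not
  simp only [heap_isChild hδ]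
  constructor
  · rintro ⟨u, i, hi⟩
    have := u.2
    omega
  · intro h
    exact ⟨⟨_, h⟩, ⟨0, hδ⟩, rfl⟩

lemma heap_isRegular (hδ : 0 < δ) {m : ℕ} (hn : n = 1 + δ * m) : (heap δ n).IsRegular δ :=
  fun _ hv => ⟨(heap_exists_equiv hδ hn ((heap_not_isLeaf_iff hδ).mp hv)).choose⟩

/-- The descendant of `v` at the end of a path in the infinite heap. -/
def heapDesc (δ v : ℕ) (x : List (Fin δ)) : ℕ :=
  x.foldl (fun (k : ℕ) (i : Fin δ) => δ * k + 1 + i) v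

lemma heapDesc_append (v : ℕ) (x y : List (Fin δ)) :
    heapDesc δ v (x ++ y) = heapDesc δ (heapDesc δ v x) y :=
  List.foldl_append

lemma heapDesc_concat (v : ℕ) (x : List (Fin δ)) (i : Fin δ) :
    heapDesc δ v (x ++ [i]) = δ * heapDesc δ v x + 1 + i := by
  rw [heapDesc_append]
  rfl

/-- A crude bound that suffices to make all levels up to `H` complete when `(δ + 1) ^ H ≤ n`. -/
lemma heapDesc_lt (x : List (Fin δ)) : heapDesc δ 0 x < (δ + 1) ^ x.length := by
  induction x using List.reverseRecOn with
  | nil => simp [heapDesc]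
  | append_singleton x i ih =>
    rw [heapDesc_concat, List.length_append, List.length_singleton, pow_succ]
    have h1 := Nat.mul_le_mul_right (δ + 1) (Nat.succ_le_of_lt ih)
    have h2 := i.2
    have h3 : (heapDesc δ 0 x).succ * (δ + 1) = δ * heapDesc δ 0 x + δ + heapDesc δ 0 x + 1 := by
      rw [Nat.succ_eq_add_one]; ring
    omega

lemma heapDesc_injective : Function.Injective (heapDesc δ 0) := by
  intro x
  induction x using List.reverseRecOn with
  | nil =>
    intro y h
    rcases List.eq_nil_or_concat' y with rfl | ⟨y, j, rfl⟩
    · rfl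
    · rw [heapDesc_concat] at h
      simp only [heapDesc, List.foldl_nil] at h
      omega
  | append_singleton x i ih =>
    intro y h
    rcases List.eq_nil_or_concat' y with rfl | ⟨y, j, rfl⟩
    · rw [heapDesc_concat] at h
      simp only [heapDesc, List.foldl_nil] at h
      omega
    · rw [heapDesc_concat, heapDesc_concat] at h
      have hδ : 0 < δ := i.pos
      have h1 : (i : ℕ) + δ * heapDesc δ 0 x = j + δ * heapDesc δ 0 y := by omega
      have h2 := congrArg (· / δ) h1
      simp only [Nat.add_mul_div_left _ _ hδ, Nat.div_eq_of_lt i.2, Nat.div_eq_of_lt j.2,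
        zero_add] at h2
      rw [h2] at h1
      rw [ih h2, Fin.ext (show (i : ℕ) = j by omega)]

end Heap

/-- The number of nodes of a regular tree. -/
lemma RootedTreeOn.IsRegular.exists_card_eq {n δ : ℕ} {T : RootedTreeOn (Fin n)}
    (hT : T.IsRegular δ) : ∃ m, n = 1 + δ * m := by
  classical
  have h1 : Fintype.card {u // u ≠ T.root} = n - 1 := by
    rw [Fintype.card_subtype_compl, Fintype.card_fin, Fintype.card_subtype_eq]
  have e : {u // u ≠ T.root} ≃ Σ v, {u // T.IsChild u v} :=
    { toFun := fun u => ⟨T.parent u, u, u.2, rfl⟩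
      invFun := fun p => ⟨p.2, p.2.2.1⟩
      left_inv := fun u => rfl
      right_inv := by
        rintro ⟨v, u, hu, rfl⟩
        rfl }
  have h2 : ∀ v, δ ∣ Fintype.card {u // T.IsChild u v} := by
    intro v
    by_cases hv : T.IsLeaf v
    · have : IsEmpty {u // T.IsChild u v} := ⟨fun u => hv u u.2⟩
      simp
    · obtain ⟨e⟩ := hT v hv
      rw [← Fintype.card_congr e, Fintype.card_fin]
  rw [Fintype.card_congr e, Fintype.card_sigma] at h1
  obtain ⟨m, hm⟩ := Finset.dvd_sum fun v (_ : v ∈ Finset.univ) => h2 v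
  refine ⟨m, ?_⟩
  have := T.root.pos
  omega

/-! ### Reading labelings off a rearranged heap. -/

namespace RootedTreeLCL

variable {δ : ℕ} {Γ : Type*} {P : RootedTreeLCL δ Γ}

lemma val_ofNat_of_lt {n k : ℕ} [NeZero n] (h : k < n) : (Fin.ofNat n k : ℕ) = k :=
  Nat.mod_eq_of_lt h

section Glue

variable {n m : ℕ} [NeZero n] {ρ : Equiv.Perm (Fin n)} {hroot : ρ (heap δ n).root = (heap δ n).root}
  {hreach : ∀ v, ∃ k : ℕ, ((heap δ n).parent ∘ ρ)^[k] v = (heap δ n).root}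

lemma allowed_of_isSolution_rewire (hδ : 0 < δ) (hn : n = 1 + δ * m) {f : Fin n → Γ}
    (hf : P.IsSolution ((heap δ n).rewire ρ hroot hreach) f) {k : ℕ} (hk : δ * k + 1 < n) :
    P.Allowed (f (Fin.ofNat n k)) fun i => f (ρ.symm (Fin.ofNat n (δ * k + 1 + i))) := by
  have hkn : k < n := by
    have := Nat.le_mul_of_pos_left k hδ
    omega
  have hv : δ * (Fin.ofNat n k : ℕ) + 1 < n := by rwa [val_ofNat_of_lt hkn]
  obtain ⟨e, he⟩ := heap_exists_equiv hδ hn hv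
  obtain ⟨e', he'⟩ := hf (Fin.ofNat n k) (by
    rw [RootedTreeOn.isLeaf_rewire]
    exact (heap_not_isLeaf_iff hδ).mpr hv)
  let τ : {u // ((heap δ n).rewire ρ hroot hreach).IsChild u (Fin.ofNat n k)} ≃
      {u // (heap δ n).IsChild u (Fin.ofNat n k)} :=
    ρ.subtypeEquiv fun _ => RootedTreeOn.isChild_rewire
  refine ⟨(e'.trans τ).trans e.symm, ?_⟩
  convert he' using 2
  funext i
  have h1 : Fin.ofNat n (δ * k + 1 + (e.symm (τ (e' i)) : Fin δ)) = (τ (e' i) : Fin n) := by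
    ext
    rw [val_ofNat_of_lt (heap_children_lt hn hk _), ← Equiv.apply_symm_apply e (τ (e' i)), he,
      val_ofNat_of_lt hkn, Equiv.apply_symm_apply]
  simp only [Function.comp_apply, Equiv.trans_apply]
  rw [h1]
  congr 1
  exact ρ.symm_apply_apply _

/-- If the subtrees at depth `g` below `r` are replaced by the subtrees at depth `g` below `c`, then
a solution labels the tree that consists of the top part of the subtree of `r` and of the bottom
part of the subtree of `c`. -/
lemma exists_labeling_of_glue (hδ : 0 < δ) (hn : n = 1 + δ * m) {f : Fin n → Γ}
    (hf : P.IsSolution ((heap δ n).rewire ρ hroot hreach) f) {r c d g : ℕ} (hg : 0 < g)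
    (hr : ∀ x : List (Fin δ), x.length ≤ g → heapDesc δ r x < n)
    (hc : ∀ x : List (Fin δ), x.length ≤ d + 1 → heapDesc δ c x < n)
    (h1 : ∀ x : List (Fin δ), x ≠ [] → x.length < g →
      ρ (Fin.ofNat n (heapDesc δ r x)) = Fin.ofNat n (heapDesc δ r x))
    (h2 : ∀ x : List (Fin δ), x.length = g →
      ρ (Fin.ofNat n (heapDesc δ c x)) = Fin.ofNat n (heapDesc δ r x))
    (h3 : ∀ x : List (Fin δ), g < x.length → x.length ≤ d + 1 →
      ρ (Fin.ofNat n (heapDesc δ c x)) = Fin.ofNat n (heapDesc δ c x)) :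
    ∃ F : List (Fin δ) → Γ, F [] = f (Fin.ofNat n r) ∧
      (∀ x, x.length ≤ d → P.AllowedAt F x) ∧
      ∀ x, g ≤ x.length → F x = f (Fin.ofNat n (heapDesc δ c x)) := by
  let F : List (Fin δ) → Γ := fun x => if x.length < g then f (Fin.ofNat n (heapDesc δ r x))
    else f (Fin.ofNat n (heapDesc δ c x))
  refine ⟨F, if_pos hg, fun x hx => ?_, fun x hx => if_neg (by omega)⟩
  have hlen : ∀ i, (x ++ [i]).length = x.length + 1 := by simp
  rcases Nat.lt_or_ge x.length g with hxg | hxg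
  · have hx1 : δ * heapDesc δ r x + 1 < n := by
      have := hr (x ++ [⟨0, hδ⟩]) (by rw [hlen]; omega)
      simpa [heapDesc_concat] using this
    have h := allowed_of_isSolution_rewire hδ hn hf hx1
    unfold AllowedAt
    convert h using 2 with i
    · exact if_pos hxg
    · rw [← heapDesc_concat]
      simp only [F, hlen]
      split_ifs with hlt
      · rw [ρ.symm_apply_eq.mpr (h1 (x ++ [i]) (by simp) (by rw [hlen]; omega)).symm]
      -- The seam: a node at level `g - 1` below `r` has in the new tree the children from level `g`
      -- below `c`.
      · rw [ρ.symm_apply_eq.mpr (h2 (x ++ [i]) (by rw [hlen]; omega)).symm]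
  · have hx1 : δ * heapDesc δ c x + 1 < n := by
      have := hc (x ++ [⟨0, hδ⟩]) (by rw [hlen]; omega)
      simpa [heapDesc_concat] using this
    have h := allowed_of_isSolution_rewire hδ hn hf hx1
    unfold AllowedAt
    convert h using 2 with i
    · exact if_neg (by omega)
    · rw [← heapDesc_concat]
      simp only [F, hlen]
      rw [if_neg (by omega), ρ.symm_apply_eq.mpr
        (h3 (x ++ [i]) (by rw [hlen]; omega) (by rw [hlen]; omega)).symm]

end Glue

/-! ### From an online algorithm to a certificate, arity at least two. -/

section Branching

lemma heapDesc_lt_of_length_le {n H : ℕ} (hH : (δ + 1) ^ H ≤ n) {w : List (Fin δ)} (hw : w.length ≤ H) :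
    heapDesc δ 0 w < n :=
  ((heapDesc_lt w).trans_le (Nat.pow_le_pow_right (Nat.succ_pos _) hw)).trans_le hH

variable {n : ℕ} [NeZero n]

/-- The node of the heap at the end of a path from the root. -/
def heapNode (n : ℕ) [NeZero n] (w : List (Fin δ)) : Fin n :=
  Fin.ofNat n (heapDesc δ 0 w)

variable {H : ℕ}

lemma heapNode_inj (hH : (δ + 1) ^ H ≤ n) {w w' : List (Fin δ)} (hw : w.length ≤ H)
    (hw' : w'.length ≤ H) (h : heapNode n w = heapNode n w') : w = w' := by
  refine heapDesc_injective ?_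
  have := congrArg Fin.val h
  unfold heapNode at this
  rwa [val_ofNat_of_lt (heapDesc_lt_of_length_le hH hw),
    val_ofNat_of_lt (heapDesc_lt_of_length_le hH hw')] at this

lemma heapNode_nil : heapNode n ([] : List (Fin δ)) = (heap δ n).root := by
  simp [heapNode, heapDesc, heap]

lemma isChild_heapNode (hH : (δ + 1) ^ H ≤ n) {w : List (Fin δ)} {i : Fin δ}
    (hw : w.length < H) : (heap δ n).IsChild (heapNode n (w ++ [i])) (heapNode n w) := by
  rw [heap_isChild i.pos]
  refine ⟨i, ?_⟩
  unfold heapNode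
  rw [val_ofNat_of_lt (heapDesc_lt_of_length_le hH (by simpa using hw)),
    val_ofNat_of_lt (heapDesc_lt_of_length_le hH hw.le), heapDesc_concat]

lemma depth_heapNode (hH : (δ + 1) ^ H ≤ n) {w : List (Fin δ)} (hw : w.length ≤ H) :
    (heap δ n).depth (heapNode n w) = w.length := by
  induction w using List.reverseRecOn with
  | nil => rw [heapNode_nil, RootedTreeOn.depth_root]; rfl
  | append_singleton w i ih =>
    rw [List.length_append, List.length_singleton] at hw ⊢
    rw [(isChild_heapNode hH (by omega)).depth_eq, ih (by omega)]

lemma parent_iterate_heapNode (hH : (δ + 1) ^ H ≤ n) (w u : List (Fin δ))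
    (hw : (w ++ u).length ≤ H) :
    (heap δ n).parent^[u.length] (heapNode n (w ++ u)) = heapNode n w := by
  induction u using List.reverseRecOn with
  | nil => simp
  | append_singleton u i ih =>
    rw [← List.append_assoc, List.length_append] at hw
    rw [List.length_append, List.length_singleton, Function.iterate_succ_apply,
      ← List.append_assoc, (isChild_heapNode hH (by simpa using hw)).2]
    exact ih (by simp at hw ⊢; omega)

lemma exists_parent_iterate_heapNode (hH : (δ + 1) ^ H ≤ n) {w : List (Fin δ)}
    (hw : w.length ≤ H) (k : ℕ) :
    (heap δ n).parent^[k] (heapNode n w) = heapNode n (w.take (w.length - k)) := by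
  rcases Nat.lt_or_ge w.length k with hk | hk
  · obtain ⟨j, rfl⟩ := Nat.exists_eq_add_of_lt hk
    have := parent_iterate_heapNode hH [] w (by simpa using hw)
    rw [List.nil_append] at this
    rw [show w.length + j + 1 = (j + 1) + w.length by omega, Function.iterate_add_apply, this,
      heapNode_nil, Function.iterate_fixed (RootedTreeOn.parent_root _),
      show w.length - (j + 1 + w.length) = 0 by omega, List.take_zero, heapNode_nil]
  · have := parent_iterate_heapNode hH (w.take (w.length - k)) (w.drop (w.length - k))
      (by simpa using hw)
    rwa [List.take_append_drop, List.length_drop, show w.length - (w.length - k) = k by omega]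
      at this

/-- If the labels that are used in two clusters of nodes are the same, there is a certificate. -/
lemma hasCertificate_of_clusters {t L m : ℕ} [NeZero δ] (hn : n = 1 + δ * m)
    {A : TreePiece (Fin n) → List (Fin n) → Γ} {σ : Equiv.Perm (Fin n)}
    (hA : ∀ T : RootedTreeOn (Fin n), T.IsRegular δ → P.IsSolution T (onlineOutput A t T σ))
    (hH : (δ + 1) ^ (L + 4 * t + 12) ≤ n)
    (hσ : ∀ v : Fin n, ((heap δ n).depth v = L + (2 * t + 5) ∨
      (heap δ n).depth v = L + (2 * t + 5) + 1) → ∀ j ≤ σ.symm v,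
      ((heap δ n).depth (σ j) = L + (2 * t + 5) ∨ (heap δ n).depth (σ j) = L + (2 * t + 5) + 1))
    {p q : List (Fin δ)} (hpq : p ≠ q) (hp : p.length = L) (hq : q.length = L)
    (hS : ∀ z : List (Fin δ), (z.length = 2 * t + 5 ∨ z.length = 2 * t + 5 + 1) →
      ∃ z' : List (Fin δ), (z'.length = 2 * t + 5 ∨ z'.length = 2 * t + 5 + 1) ∧
        onlineOutput A t (heap δ n) σ (heapNode n (q ++ z')) =
          onlineOutput A t (heap δ n) σ (heapNode n (p ++ z))) :
    P.HasCertificate := by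
  have hδ : 0 < δ := NeZero.pos δ
  set T := heap δ n with hTdef
  set d := 2 * t + 5 with hd
  -- The clusters occupy depths `d` and `d + 1` below level `L`; the algorithm sees relative depths
  -- `t + 5` to `3 * t + 6`. The changed edges lie just above relative depths `g` and `z.length +
  -- g`, thus strictly outside that range.
  set g := t + 3 with hg
  set H := L + 4 * t + 12 with hHdef
  set ℓ := onlineOutput A t T σ with hℓ
  refine ⟨{a | ∃ z : List (Fin δ), (z.length = d ∨ z.length = d + 1) ∧ ℓ (heapNode n (p ++ z)) = a},
    d, fun x => ℓ (heapNode n (p ++ x)),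
    ⟨_, List.replicate d 0, Or.inl (by simp), rfl⟩, by omega, ?_⟩
  rintro a ⟨z₀, hz₀, rfl⟩
  obtain ⟨z, hz, hza⟩ := hS z₀ hz₀
  rw [← hza]
  have hzd : d ≤ z.length ∧ z.length ≤ d + 1 := by omega
  let X := {x : List (Fin δ) // x.length = g}
  let fr : X → Fin n := fun x => heapNode n ((q ++ z) ++ x.1)
  let fc : X → Fin n := fun x => heapNode n (p ++ x.1)
  have hfrl : ∀ x : X, ((q ++ z) ++ x.1).length = L + z.length + g := fun x => by
    rw [List.length_append, List.length_append, x.2, hq]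
  have hfcl : ∀ x : X, (p ++ x.1).length = L + g := fun x => by
    rw [List.length_append, x.2, hp]
  have hfr : Function.Injective fr := fun x y hxy => by
    have := heapNode_inj hH (by rw [hfrl]; omega) (by rw [hfrl]; omega) hxy
    exact Subtype.ext (List.append_cancel_left this)
  have hfc : Function.Injective fc := fun x y hxy => by
    have := heapNode_inj hH (by rw [hfcl]; omega) (by rw [hfcl]; omega) hxy
    exact Subtype.ext (List.append_cancel_left this)
  have hne : ∀ x y, fr x ≠ fc y := fun x y hxy => by
    have := heapNode_inj hH (by rw [hfrl]; omega) (by rw [hfcl]; omega) hxy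
    have := congrArg List.length this
    rw [hfrl, hfcl] at this
    omega
  obtain ⟨ρ, hρr, hρc, hρ⟩ := exists_perm_exchanging hfr hfc hne
  have hfix : ∀ w : List (Fin δ), w.length ≤ H → (∀ x : X, w ≠ (q ++ z) ++ x.1) →
      (∀ x : X, w ≠ p ++ x.1) → ρ (heapNode n w) = heapNode n w := by
    intro w hw h1 h2
    by_contra hcon
    obtain ⟨x, hx | hx⟩ := hρ _ hcon
    · exact h1 x (heapNode_inj hH hw (by rw [hfrl]; omega) hx)
    · exact h2 x (heapNode_inj hH hw (by rw [hfcl]; omega) hx)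
  have hfix' : ∀ w : List (Fin δ), w.length ≤ H → w.length ≠ L + z.length + g →
      w.length ≠ L + g → ρ (heapNode n w) = heapNode n w := by
    intro w hw h1 h2
    refine hfix w hw ?_ ?_
    · rintro x rfl
      exact h1 (hfrl x)
    · rintro x rfl
      exact h2 (hfcl x)
  have hroot : ρ T.root = T.root := by
    rw [hTdef, ← heapNode_nil]
    exact hfix' _ (by simp) (by simp only [List.length_nil]; omega)
      (by simp only [List.length_nil]; omega)
  -- The moved nodes form an antichain: within a family they have equal depth, and across families
  -- their paths already differ in the first `L` ports, since `p ≠ q`.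
  have hreach := T.reaches_root_of_antichain (ρ := ρ) (by
    intro v hv k
    obtain ⟨x, rfl | rfl⟩ := hρ v hv
    · simp only [fr]
      rw [exists_parent_iterate_heapNode hH (by rw [hfrl]; omega)]
      refine hfix _ ?_ ?_ ?_
      · rw [List.length_take, hfrl]
        omega
      · intro y hy
        have := congrArg List.length hy
        rw [List.length_take, hfrl, hfrl] at this
        omega
      · intro y hy
        rw [hfrl] at hy
        have h1 := congrArg (List.take L) hy
        have h2 := congrArg List.length hy
        rw [List.length_take, hfrl, hfcl] at h2
        rw [List.take_take, List.append_assoc, List.take_append_of_le_length (by omega),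
          List.take_append_of_le_length (by omega), List.take_of_length_le hp.le,
          List.take_of_length_le (by omega)] at h1
        exact hpq h1.symm
    · simp only [fc]
      rw [exists_parent_iterate_heapNode hH (by rw [hfcl]; omega)]
      refine hfix' _ ?_ ?_ ?_ <;> rw [List.length_take, hfcl] <;> omega)
  set T' := T.rewire ρ hroot hreach with hT'
  have hreg : T'.IsRegular δ := (heap_isRegular hδ hn).rewire
  have hdepth : ∀ v, ρ v ≠ v → ((T.depth v = L + g ∧ T.depth (T.parent v) = L + g - 1) ∨
      (T.depth v = L + z.length + g ∧ T.depth (T.parent v) = L + z.length + g - 1)) := by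
    intro v hv
    have hne : v ≠ T.root := by
      rintro rfl
      exact hv hroot
    have h1 := T.depth_eq_succ hne
    obtain ⟨x, rfl | rfl⟩ := hρ v hv
    · have := depth_heapNode hH (w := (q ++ z) ++ x.1) (by rw [hfrl]; omega)
      rw [hfrl, ← hTdef] at this
      simp only [fr] at h1 ⊢
      omega
    · have := depth_heapNode hH (w := p ++ x.1) (by rw [hfcl]; omega)
      rw [hfcl, ← hTdef] at this
      simp only [fc] at h1 ⊢
      omega
  let U : ℕ → Set (Fin n) := fun s => {v | L + d ≤ T.depth v + s ∧ T.depth v ≤ L + d + 1 + s}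
  have hU0 : ∀ v, v ∈ U 0 ↔ (T.depth v = L + d ∨ T.depth v = L + d + 1) := by
    intro v
    simp only [U, Set.mem_ofPred_eq]
    omega
  have hsame : ∀ v ∈ U 0, ℓ v = onlineOutput A t T' σ v := by
    intro v hv
    refine onlineOutput_eq_of_agree A (U := U) ?_ ?_ ?_ ?_ hv
    · intro v hv j hj
      rw [hU0] at hv ⊢
      exact hσ v hv j hj
    · intro s v
      simp only [U, Set.mem_ofPred_eq]
      omega
    · intro s x hx y hxy
      simp only [U, Set.mem_ofPred_eq] at hx ⊢
      rcases T.adj_iff.mp hxy with h | h <;> have := h.depth_eq <;> omega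
    · intro x y hxy
      refine RootedTreeOn.isChild_rewire_iff_of_notMem (fun v hv => ?_) hxy
      simp only [U, Set.mem_ofPred_eq]
      have := hdepth v hv
      omega
  have hmem : ∀ (w x : List (Fin δ)), w.length = L → (x.length = d ∨ x.length = d + 1) →
      heapNode n (w ++ x) ∈ U 0 := by
    intro w x hw hx
    have : (w ++ x).length = L + x.length := by rw [List.length_append, hw]
    rw [hU0, depth_heapNode hH (by omega), this]
    omega
  obtain ⟨F, hF0, hF1, hF2⟩ := exists_labeling_of_glue hδ hn (hA T' hreg)
    (r := heapDesc δ 0 (q ++ z)) (c := heapDesc δ 0 p) (d := d) (g := g) (by omega)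
    (by
      intro x hx
      rw [← heapDesc_append]
      refine heapDesc_lt_of_length_le hH ?_
      rw [List.length_append, List.length_append]
      omega)
    (by
      intro x hx
      rw [← heapDesc_append]
      refine heapDesc_lt_of_length_le hH ?_
      rw [List.length_append]
      omega)
    (by
      intro x hx0 hx
      rw [← heapDesc_append]
      have hx1 := List.length_pos_of_ne_nil hx0
      refine hfix' _ ?_ ?_ ?_ <;> rw [List.length_append, List.length_append] <;> omega)
    (by
      intro x hx
      rw [← heapDesc_append, ← heapDesc_append]
      exact hρc ⟨x, hx⟩)
    (by
      intro x hx1 hx2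
      rw [← heapDesc_append]
      refine hfix' _ ?_ ?_ ?_ <;> rw [List.length_append] <;> omega)
  refine ⟨F, hF0.trans (hsame _ (hmem q z hq hz)).symm, hF1, fun x hx => ?_, fun x hx => ?_⟩
  · have : F x = ℓ (heapNode n (p ++ x)) := by
      rw [hF2 x (by omega), hsame _ (hmem p x hp (Or.inl hx)), ← heapDesc_append]
      rfl
    exact ⟨this, x, Or.inl hx, this.symm⟩
  · refine ⟨x, Or.inr hx, ?_⟩
    rw [hF2 x (by omega), hsame _ (hmem p x hp (Or.inr hx)), ← heapDesc_append]
    rfl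

/-- Pigeonhole: level `L = Nat.card Γ + 1` has `δ ^ L ≥ 2 ^ L` nodes, more than there are sets of
labels. -/
lemma hasCertificate_of_two_le [Finite Γ] {t : ℕ} (hδ : 2 ≤ δ) (h : P.OnlineSolvable n t)
    {m : ℕ} (hn : n = 1 + δ * m) (hH : (δ + 1) ^ (Nat.card Γ + 1 + 4 * t + 12) ≤ n) :
    P.HasCertificate := by
  have : NeZero δ := ⟨by omega⟩
  have := Fintype.ofFinite Γ
  obtain ⟨A, -, hA⟩ := h
  set L := Nat.card Γ + 1 with hL
  obtain ⟨σ, hσ⟩ := exists_perm_presenting {v : Fin n | (heap δ n).depth v = L + (2 * t + 5) ∨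
    (heap δ n).depth v = L + (2 * t + 5) + 1}
  let S : List.Vector (Fin δ) L → Set Γ := fun p => {a | ∃ z : List (Fin δ),
    (z.length = 2 * t + 5 ∨ z.length = 2 * t + 5 + 1) ∧
      onlineOutput A t (heap δ n) σ (heapNode n (p.1 ++ z)) = a}
  have hcard : Fintype.card (Set Γ) < Fintype.card (List.Vector (Fin δ) L) := by
    classical
    rw [Fintype.card_set, card_vector, Fintype.card_fin, ← Nat.card_eq_fintype_card, hL, pow_succ]
    have h1 := Nat.pow_le_pow_left hδ (Nat.card Γ)
    have h2 : 0 < 2 ^ Nat.card Γ := by positivity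
    nlinarith
  obtain ⟨p, q, hpq, hS⟩ := Fintype.exists_ne_map_eq_of_card_lt S hcard
  refine hasCertificate_of_clusters hn (fun T hT => hA T hT σ) hH hσ
    (fun h => hpq (Subtype.ext h)) p.2 q.2 fun z hz => ?_
  have : onlineOutput A t (heap δ n) σ (heapNode n (p.1 ++ z)) ∈ S p := ⟨z, hz, rfl⟩
  rw [hS] at this
  exact this

end Branching

end RootedTreeLCL

/-! ### From an online algorithm to a certificate, arity one. -/

namespace RootedTreeLCL

section Path

lemma heapDesc_one (v : ℕ) (x : List (Fin 1)) : heapDesc 1 v x = v + x.length := by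
  induction x using List.reverseRecOn with
  | nil => rfl
  | append_singleton x i ih =>
    rw [heapDesc_concat, ih, List.length_append, List.length_singleton]
    have := i.2
    omega

variable {Γ : Type*} {P : RootedTreeLCL 1 Γ} {n : ℕ} [NeZero n]

lemma path_isChild {u v : Fin n} : (heap 1 n).IsChild u v ↔ (u : ℕ) = v + 1 := by
  rw [heap_isChild one_pos]
  constructor
  · rintro ⟨i, hi⟩
    have := i.2
    omega
  · intro h
    exact ⟨0, by simp; omega⟩

set_option maxHeartbeats 2000000 in
/-- If the labels that are used in two segments of the path are the same, there is a
certificate. -/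
lemma hasCertificate_of_segments {t H i j : ℕ}
    {A : TreePiece (Fin n) → List (Fin n) → Γ} {σ : Equiv.Perm (Fin n)}
    (hA : ∀ T : RootedTreeOn (Fin n), T.IsRegular 1 → P.IsSolution T (onlineOutput A t T σ))
    (hHt : H = 4 * t + 20) (hji : j < i) (hn : (i + 2) * H ≤ n)
    (hσ : ∀ v : Fin n, (∃ k, (v : ℕ) = k * H + (2 * t + 5) ∨ (v : ℕ) = k * H + (2 * t + 5) + 1) →
      ∀ l ≤ σ.symm v,
        ∃ k, (σ l : ℕ) = k * H + (2 * t + 5) ∨ (σ l : ℕ) = k * H + (2 * t + 5) + 1)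
    (hS : ∀ z, (z = 2 * t + 5 ∨ z = 2 * t + 5 + 1) →
      ∃ z', (z' = 2 * t + 5 ∨ z' = 2 * t + 5 + 1) ∧
        onlineOutput A t (heap 1 n) σ (Fin.ofNat n (j * H + z')) =
          onlineOutput A t (heap 1 n) σ (Fin.ofNat n (i * H + z))) :
    P.HasCertificate := by
  have hn1 : n = 1 + 1 * (n - 1) := by
    have := NeZero.pos n
    omega
  have hmono : ∀ {k l : ℕ}, k < l → k * H + H ≤ l * H := fun {k l} hkl => by
    rw [← Nat.succ_mul]
    exact Nat.mul_le_mul_right H hkl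
  have hab := hmono hji
  have hbn : i * H + H + H ≤ n := by
    have : (i + 2) * H = i * H + H + H := by ring
    omega
  obtain ⟨d, hd⟩ : ∃ d, d = 2 * t + 5 := ⟨_, rfl⟩
  obtain ⟨g, hg⟩ : ∃ g, g = t + 3 := ⟨_, rfl⟩
  simp only [← hd] at hσ hS
  set T := heap 1 n with hTdef
  set ℓ := onlineOutput A t T σ with hℓ
  refine ⟨{a | ∃ z, (z = d ∨ z = d + 1) ∧ ℓ (Fin.ofNat n (i * H + z)) = a}, d,
    fun x => ℓ (Fin.ofNat n (i * H + x.length)), ⟨_, d, Or.inl rfl, rfl⟩, by omega, ?_⟩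
  rintro a ⟨z₀, hz₀, rfl⟩
  obtain ⟨z, hz, hza⟩ := hS z₀ hz₀
  rw [← hza]
  obtain ⟨y, hy⟩ : ∃ y, y = j * H + z + g := ⟨_, rfl⟩
  obtain ⟨c, hc⟩ : ∃ c, c = i * H + g := ⟨_, rfl⟩
  obtain ⟨w, hw⟩ : ∃ w, w = i * H + H := ⟨_, rfl⟩
  have hyv : (Fin.ofNat n y : ℕ) = y := val_ofNat_of_lt (by omega)
  have hcv : (Fin.ofNat n c : ℕ) = c := val_ofNat_of_lt (by omega)
  have hwv : (Fin.ofNat n w : ℕ) = w := val_ofNat_of_lt (by omega)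
  -- The path is cut before `y`, `c` and `w`, and its two middle segments are interchanged. Thus `c`
  -- follows `y - 1`, which joins the top at `j * H + z` to the bottom from segment `i`.
  let ρ : Equiv.Perm (Fin n) :=
    Equiv.swap (Fin.ofNat n c) (Fin.ofNat n w) * Equiv.swap (Fin.ofNat n c) (Fin.ofNat n y)
  have hρ : ∀ v : Fin n, (ρ v : ℕ) =
      if (v : ℕ) = c then y else if (v : ℕ) = y then w else if (v : ℕ) = w then c else v := by
    intro v
    simp only [ρ, Equiv.Perm.mul_apply, Equiv.swap_apply_def, Fin.ext_iff]
    split_ifs <;> omega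
  have hpar : ∀ v : Fin n, (T.parent v : ℕ) = v - 1 := fun v => Nat.div_one _
  have hfix : ∀ v : Fin n, (v : ℕ) ≠ c → (v : ℕ) ≠ y → (v : ℕ) ≠ w → ρ v = v := by
    intro v h1 h2 h3
    ext
    rw [hρ, if_neg h1, if_neg h2, if_neg h3]
  have hroot0 : (T.root : ℕ) = 0 := rfl
  have hroot : ρ T.root = T.root := hfix _ (by omega) (by omega) (by omega)
  have hreach := RootedTreeOn.reaches_root_of_rank (r := T.root) (p := T.parent ∘ ρ)
    -- The rank is the position of the node in the reordered path.
    (fun v => if (v : ℕ) < y then (v : ℕ) else if (v : ℕ) < c then v + (w - c)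
      else if (v : ℕ) < w then v - (c - y) else v) (by
    intro v hv
    have hv0 : (v : ℕ) ≠ 0 := fun h => hv (Fin.ext (by omega))
    simp only [Function.comp_apply, hpar, hρ]
    split_ifs <;> omega)
  set T' := T.rewire ρ hroot hreach with hT'
  have hreg : T'.IsRegular 1 := (heap_isRegular one_pos hn1).rewire
  let U : ℕ → Set (Fin n) := fun s =>
    {v | ∃ k, k * H + d ≤ (v : ℕ) + s ∧ (v : ℕ) ≤ k * H + d + 1 + s}
  have hU0 : ∀ v, v ∈ U 0 ↔ ∃ k, (v : ℕ) = k * H + d ∨ (v : ℕ) = k * H + d + 1 := by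
    intro v
    simp only [U, Set.mem_ofPred_eq]
    exact exists_congr fun k => by omega
  have hnotU : ∀ u : Fin n, ((u : ℕ) = c ∨ (u : ℕ) = y ∨ (u : ℕ) = w ∨ (u : ℕ) + 1 = c ∨
      (u : ℕ) + 1 = y ∨ (u : ℕ) + 1 = w) → u ∉ U t := by
    rintro u hu ⟨k, hk1, hk2⟩
    have hkj : k * H + H ≤ j * H ∨ k * H = j * H ∨ j * H + H ≤ k * H := by
      rcases lt_trichotomy k j with h | rfl | h
      · exact Or.inl (hmono h)
      · exact Or.inr (Or.inl rfl)
      · exact Or.inr (Or.inr (hmono h))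
    have hki : k * H + H ≤ i * H ∨ k * H = i * H ∨ i * H + H ≤ k * H := by
      rcases lt_trichotomy k i with h | rfl | h
      · exact Or.inl (hmono h)
      · exact Or.inr (Or.inl rfl)
      · exact Or.inr (Or.inr (hmono h))
    omega
  have hsame : ∀ v ∈ U 0, ℓ v = onlineOutput A t T' σ v := by
    intro v hv
    refine onlineOutput_eq_of_agree A (U := U) ?_ ?_ ?_ ?_ hv
    · intro v hv j hj
      rw [hU0] at hv ⊢
      exact hσ v hv j hj
    · rintro s v ⟨k, hk⟩
      exact ⟨k, by omega⟩
    · rintro s x ⟨k, hk⟩ x' hxx'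
      refine ⟨k, ?_⟩
      rcases T.adj_iff.mp hxx' with h | h <;> have := path_isChild.mp h <;> omega
    · intro x x' hxx'
      refine RootedTreeOn.isChild_rewire_iff_of_notMem (fun v hv => ?_) hxx'
      have hv' : (v : ℕ) = c ∨ (v : ℕ) = y ∨ (v : ℕ) = w := by
        by_contra! hcon
        exact hv (hfix v hcon.1 hcon.2.1 hcon.2.2)
      have := hpar v
      exact ⟨hnotU v (by omega), hnotU _ (by omega)⟩
  have hmem : ∀ k x : ℕ, k * H + x < n → (x = d ∨ x = d + 1) → Fin.ofNat n (k * H + x) ∈ U 0 := by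
    intro k x hlt hx
    rw [hU0, val_ofNat_of_lt hlt]
    exact ⟨k, by omega⟩
  obtain ⟨F, hF0, hF1, hF2⟩ := exists_labeling_of_glue one_pos hn1 (hA T' hreg)
    (r := j * H + z) (c := i * H) (d := d) (g := g) (by omega)
    (by
      intro x hx
      rw [heapDesc_one]
      omega)
    (by
      intro x hx
      rw [heapDesc_one]
      omega)
    (by
      intro x hx0 hx
      have hx1 := List.length_pos_of_ne_nil hx0
      rw [heapDesc_one]
      have hval := val_ofNat_of_lt (n := n) (k := j * H + z + x.length) (by omega)
      exact hfix _ (by omega) (by omega) (by omega))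
    (by
      intro x hx
      ext
      rw [heapDesc_one, heapDesc_one, hx, ← hc, ← hy, hρ, hcv, hyv, if_pos rfl])
    (by
      intro x hx1 hx2
      rw [heapDesc_one]
      have hval := val_ofNat_of_lt (n := n) (k := i * H + x.length) (by omega)
      exact hfix _ (by omega) (by omega) (by omega))
  refine ⟨F, hF0.trans (hsame _ (hmem j z (by omega) hz)).symm, hF1, fun x hx => ?_,
    fun x hx => ?_⟩
  · have : F x = ℓ (Fin.ofNat n (i * H + x.length)) := by
      rw [hF2 x (by omega), hsame _ (hmem i _ (by omega) (Or.inl hx)), heapDesc_one]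
    exact ⟨this, x.length, Or.inl hx, this.symm⟩
  · refine ⟨x.length, Or.inr hx, ?_⟩
    rw [hF2 x (by omega), hsame _ (hmem i _ (by omega) (Or.inr hx)), heapDesc_one]

/-- Pigeonhole over `2 ^ Nat.card Γ + 1` segments. Equality of label sets is symmetric, so the later
of the two segments can always play the part of `i`. -/
lemma hasCertificate_of_path [Finite Γ] {t : ℕ} (h : P.OnlineSolvable n t)
    (hn : (2 ^ Nat.card Γ + 2) * (4 * t + 20) ≤ n) : P.HasCertificate := by
  have := Fintype.ofFinite Γ
  obtain ⟨A, -, hA⟩ := h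
  obtain ⟨H, hH⟩ : ∃ H, H = 4 * t + 20 := ⟨_, rfl⟩
  obtain ⟨σ, hσ⟩ := exists_perm_presenting {v : Fin n | ∃ k,
    (v : ℕ) = k * H + (2 * t + 5) ∨ (v : ℕ) = k * H + (2 * t + 5) + 1}
  let S : Fin (2 ^ Nat.card Γ + 1) → Set Γ := fun k => {a | ∃ z,
    (z = 2 * t + 5 ∨ z = 2 * t + 5 + 1) ∧
      onlineOutput A t (heap 1 n) σ (Fin.ofNat n (k * H + z)) = a}
  have hcard : Fintype.card (Set Γ) < Fintype.card (Fin (2 ^ Nat.card Γ + 1)) := by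
    classical
    rw [Fintype.card_set, Fintype.card_fin, ← Nat.card_eq_fintype_card]
    exact Nat.lt_succ_self _
  obtain ⟨i, j, hij, hS⟩ := Fintype.exists_ne_map_eq_of_card_lt S hcard
  have key : ∀ i j, j < i → S i = S j → P.HasCertificate := by
    intro i j hji hS
    refine hasCertificate_of_segments (fun T hT => hA T hT σ) hH (Fin.lt_def.mp hji) ?_ hσ
      fun z hz => ?_
    · refine le_trans ?_ hn
      rw [hH]
      refine Nat.mul_le_mul_right _ ?_
      have := i.2
      omega
    · have : onlineOutput A t (heap 1 n) σ (Fin.ofNat n (i * H + z)) ∈ S i := ⟨z, hz, rfl⟩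
      rw [hS] at this
      exact this
  rcases lt_or_gt_of_ne hij with h | h
  · exact key j i h hS.symm
  · exact key i j h hS

end Path

/-! ### The gap and the equivalence. -/

variable {δ : ℕ} {Γ : Type*} {P : RootedTreeLCL δ Γ}

/-- A fast online-LOCAL algorithm yields a certificate. -/
theorem OnlineSolvable.hasCertificate [Finite Γ] {n t : ℕ} (hδ : 0 < δ)
    (h : P.OnlineSolvable n t) {T : RootedTreeOn (Fin n)} (hT : T.IsRegular δ)
    (hn : (δ + 1) ^ (Nat.card Γ + 4 * t + 22) ≤ n) : P.HasCertificate := by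
  have : NeZero n := ⟨by have := T.root.pos; omega⟩
  obtain ⟨m, hm⟩ := hT.exists_card_eq
  rcases Nat.lt_or_ge δ 2 with h2 | h2
  · obtain rfl : δ = 1 := by omega
    refine hasCertificate_of_path h (le_trans ?_ hn)
    have h1 : 4 * t + 20 < 2 ^ (4 * t + 20) := Nat.lt_two_pow_self
    have h3 : 1 ≤ 2 ^ Nat.card Γ := Nat.one_le_two_pow
    calc (2 ^ Nat.card Γ + 2) * (4 * t + 20) ≤ (2 ^ Nat.card Γ * 4) * 2 ^ (4 * t + 20) :=
          Nat.mul_le_mul (by omega) h1.le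
      _ = (1 + 1) ^ (Nat.card Γ + 4 * t + 22) := by ring
  · exact hasCertificate_of_two_le h2 h hm
      (le_trans (Nat.pow_le_pow_right (Nat.succ_pos _) (by omega)) hn)

lemma exists_onlineSolvable_of_lt {n : ℕ} {x : ℝ}
    (h : ¬ ENNReal.ofReal x ≤ (P.onlineLocality n : ℝ≥0∞)) :
    ∃ t : ℕ, P.OnlineSolvable n t ∧ (t : ℝ) < x := by
  by_contra! hcon
  refine h ?_
  have h1 : ((⌈x⌉₊ : ℕ) : ℕ∞) ≤ P.onlineLocality n :=
    le_iInf₂ fun t ht => by exact_mod_cast Nat.ceil_le.mpr (hcon t ht)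
  refine le_trans ?_ (ENat.toENNReal_le.mpr h1)
  rw [ENat.toENNReal_coe, ← ENNReal.ofReal_natCast]
  exact ENNReal.ofReal_le_ofReal (Nat.le_ceil x)

lemma hasCertificate_of_not_isOmegaLog [Finite Γ] (hδ : 0 < δ)
    (h : ¬ IsOmegaLog δ P.onlineLocality) : P.HasCertificate := by
  unfold IsOmegaLog at h
  push Not at h
  have hlog : 0 < Real.log ((δ + 1 : ℕ) : ℝ) :=
    Real.log_pos (by exact_mod_cast Nat.lt_add_of_pos_left hδ)
  obtain ⟨n₀, hn₀⟩ := eventually_atTop.mp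
    ((Real.tendsto_log_atTop.comp tendsto_natCast_atTop_atTop).eventually_ge_atTop
      (2 * ((Nat.card Γ + 22 : ℕ) * Real.log ((δ + 1 : ℕ) : ℝ))))
  -- With this constant, `4 * t * log (δ + 1)` is below half of `log n`; the choice of `n₀` leaves
  -- the other half for the constant part of the exponent.
  obtain ⟨n, hn, ⟨T, hT⟩, hlt⟩ := h (1 / (8 * Real.log ((δ + 1 : ℕ) : ℝ))) (by positivity) n₀
  obtain ⟨t, ht, htn⟩ := exists_onlineSolvable_of_lt (not_le.mpr hlt)
  refine ht.hasCertificate hδ hT ?_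
  have h1 := hn₀ n hn
  rw [Function.comp_apply] at h1
  rw [div_mul_eq_mul_div, one_mul, lt_div_iff₀ (by positivity)] at htn
  have hnpos : (0 : ℝ) < n := by exact_mod_cast T.root.pos
  have h2 : Real.log (((δ + 1) ^ (Nat.card Γ + 4 * t + 22) : ℕ) : ℝ) ≤ Real.log n := by
    rw [Nat.cast_pow, Real.log_pow]
    push_cast at h1 htn ⊢
    linarith
  have h3 := (Real.log_le_log_iff (by positivity) hnpos).mp h2
  exact_mod_cast h3

end RootedTreeLCL

/-- For arity 0 the only instance is a single node, so the bound is vacuous from `n = 2` on. -/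
lemma isOmegaLog_zero (f : ℕ → ℕ∞) : IsOmegaLog 0 f := by
  refine ⟨1, one_pos, 2, ?_⟩
  rintro n hn ⟨T, hT⟩
  obtain ⟨m, hm⟩ := hT.exists_card_eq
  omega

theorem mainTheorem4 {δ : ℕ} {Γ : Type*} [Finite Γ] (P : RootedTreeLCL δ Γ)
    (M : ℕ → ℕ) (hM : ∀ n, n ≤ M n)
    (hMpoly : ∃ k : ℕ, (fun n : ℕ => (M n : ℝ)) =O[atTop] fun n : ℕ => (n : ℝ) ^ k) :
    IsOmegaLog δ (P.localLocality M) ↔ IsOmegaLog δ P.onlineLocality := by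
  constructor
  · intro h
    by_contra hcon
    rcases Nat.eq_zero_or_pos δ with rfl | hδ
    · exact hcon (isOmegaLog_zero _)
    · have : NeZero δ := ⟨hδ.ne'⟩
      refine (P.hasCertificate_of_not_isOmegaLog hδ hcon).not_isOmegaLog hM hMpoly ?_ h
      -- The failure of the Ω-bound itself supplies arbitrarily large instances.
      unfold IsOmegaLog at hcon
      push Not at hcon
      intro n₀
      obtain ⟨n, hn, hT, -⟩ := hcon 1 one_pos n₀
      exact ⟨n, hn, hT⟩
  · rintro ⟨c, hc, n₀, h⟩
    exact ⟨c, hc, n₀, fun n hn hT => (h n hn hT).trans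
      (ENat.toENNReal_le.mpr (P.onlineLocality_le_localLocality (hM n)))⟩
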